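/- Let $\lambda=(\lambda_i)_{i\ge1}$ and $\rho=(\rho_i)_{i\ge1}$ be probability distributions on $\{1,2,\dots\}$ (the edge-perspective variable and check node degree distributions), and put $\lambda(x)=\sum_{i\ge1}\lambda_i x^{i-1}$, $\rho(x)=\sum_{i\ge1}\rho_i x^{i-1}$ for $x\in[0,\infty]$, and $\rho'(1)=\sum_{i\ge2}(i-1)\rho_i\in[0,\infty]$ (with $0\cdot\infty=0$ and $x^0=1$). *Channel.* Consider a memoryless binary-input output-symmetric channel with transition densities $f(y|0)=f(-y|1)$, $y\in\mathbb R$, with respect to a reference measure $\nu$ on $\mathbb R$ that is invariant under $y\mapsto-y$ (e.g. Lebesgue measure, or counting measure on a countable symmetric set), and let $D=\int\sqrt{f(y|0)f(y|1)}\,d\nu(y)$ be its Bhattacharyya parameter. *Ensemble.* A finite ensemble is given by the degrees ($\geq 1$) of $n$ variable nodes and of finitely many check nodes with equal degree sums; its members are the bipartite multigraphs obtained by joining variable sockets to check sockets by a uniformly random bijection. A sequence of finite ensembles realizes the $(\lambda,\rho)$ LDPC ensemble if $n\to\infty$ and, for each $d\ge 1$, the fraction of edges incident with a variable (respectively check)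 node of degree $d$ tends to $\lambda_d$ (respectively $\rho_d$). *Decoding.* A codeword of the code defined by the graph is transmitted, and the sum-product (SP) or min-sum (MS) message passing algorithm is run for $l$ iterations: initially each variable node sends the likelihoods $f(y|b)$, respectively the costs $-\log f(y|b)$, $b\in\{0,1\}$, on all its edges; in each iteration every check node and then every variable node sends along each of its edges the message computed, by the sum-product respectively min-sum rule, from the messages received on its other edges and, at a variable node, from the channel observation. The average bit error probability of a finite ensemble after $l$ iterations is the probability, over the graph, the channel and a uniformly random edge, that the message sent by the variable node along that edge after $l$ iterations decides wrongly for the bit of that node. A tie is broken by a fair coin under SP, and under MS counts as an error with a fixed weight $\tau\in[\tfrac12,1]$ ($\tau=\frac12$ is a fair coin; with $\tau=1$ every tie is an error). **Theorem.** For every $l\ge0$ there are numbers $P_l^{SP}$ and $P_l^{MS}$, depending only on $l$, $\lambda$, $\rho$ and the channel (and, for MS, on $\tau$), such that along every sequence of finite ensembles that realizes $(\lambda,\rho)$, and for every choice of the transmitted codeword for each graph (for instance the all-zero codeword), the average bit error probabilities after $l$ iterations under SP and MS decoding converge to $P_l^{SP}$ and $P_l^{MS}$, respectively. Moreover, if $z_0=D$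 and $z_l=\lambda(\rho'(1)\,z_{l-1})$ for $l\ge1$, then $$P_l^{SP}\le P_l^{MS}\le z_l\qquad\text{for all } l\ge0 .$$ -/

import Mathlib

open MeasureTheory Filter Topology
open scoped NNReal ENNReal

noncomputable section

namespace LDPC

/-- A memoryless binary-input output-symmetric channel with real output: transition densities
`f b y` (the density of the output `y` given the input bit `b`) with respect to a reference measure
`ref` that is invariant under `y ↦ -y`, with `f 0 y = f 1 (-y)`. Lebesgue measure as `ref` gives
the continuous channels, counting measure on a countable symmetric set the discrete ones. -/
structure MBIOSChannel where
  ref : Measure ℝ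
  ref_neg : ref.map (fun y => -y) = ref
  f : ZMod 2 → ℝ → ℝ≥0
  measurable_f : ∀ b, Measurable (f b)
  lintegral_f : ∀ b, ∫⁻ y, (f b y : ℝ≥0∞) ∂ref = 1
  symm : ∀ y, f 0 y = f 1 (-y)

/-- The law of the channel output when the bit `b` is sent. -/
def MBIOSChannel.law (W : MBIOSChannel) (b : ZMod 2) : Measure ℝ :=
  W.ref.withDensity (fun y => (W.f b y : ℝ≥0∞))

/-- The Bhattacharyya parameter `D = ∫ √(f(y|0) f(y|1)) dy`. -/
def MBIOSChannel.bhattacharyya (W : MBIOSChannel) : ℝ≥0∞ :=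
  ∫⁻ y, (NNReal.sqrt (W.f 0 y * W.f 1 y) : ℝ≥0∞) ∂W.ref

/-- `p(x) = ∑_{i ≥ 1} p_i x^(i-1)`, for an edge-perspective degree distribution `p`. -/
def degreeSeries (p : PMF ℕ+) (x : ℝ≥0∞) : ℝ≥0∞ :=
  ∑' i : ℕ+, p i * x ^ ((i : ℕ) - 1)

/-- The derivative `p'(x) = ∑_{i ≥ 2} (i-1) p_i x^(i-2)` of the power series `degreeSeries p`
(the term `i = 1` vanishes). -/
def degreeSeriesDeriv (p : PMF ℕ+) (x : ℝ≥0∞) : ℝ≥0∞ :=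
  ∑' i : ℕ+, (((i : ℕ) - 1 : ℕ) : ℝ≥0∞) * p i * x ^ ((i : ℕ) - 2)

/-- `z_0 = D` and `z_{l+1} = λ(ρ'(1) z_l)`. -/
def zSeq (lam rho : PMF ℕ+) (D : ℝ≥0∞) : ℕ → ℝ≥0∞
  | 0 => D
  | l + 1 => degreeSeries lam (degreeSeriesDeriv rho 1 * zSeq lam rho D l)

/-- The data of a finite LDPC ensemble: `n` variable nodes with degrees `dv`, `m` check nodes with
degrees `dc`, and the same number of edges on both sides. -/
structure Ensemble where
  n : ℕ
  m : ℕ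
  dv : Fin n → ℕ+
  dc : Fin m → ℕ+
  sum_eq : ∑ i, (dv i : ℕ) = ∑ j, (dc j : ℕ)

namespace Ensemble

variable (G : Ensemble)

/-- The edge sockets of the variable nodes. -/
abbrev VSocket : Type := (i : Fin G.n) × Fin (G.dv i : ℕ)

/-- The edge sockets of the check nodes. -/
abbrev CSocket : Type := (j : Fin G.m) × Fin (G.dc j : ℕ)

/-- The members of the ensemble: the bipartite multigraphs obtained by joining the variable sockets
to the check sockets by a bijection. An edge is identified with its variable socket. -/
abbrev Graph : Type := G.VSocket ≃ G.CSocket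

/-- The fraction of edges that are incident with a variable node of degree `d`. -/
def varEdgeFraction (d : ℕ+) : ℝ≥0∞ :=
  (Fintype.card {s : G.VSocket // G.dv s.1 = d} : ℝ≥0∞) / (Fintype.card G.VSocket : ℝ≥0∞)

/-- The fraction of edges that are incident with a check node of degree `d`. -/
def chkEdgeFraction (d : ℕ+) : ℝ≥0∞ :=
  (Fintype.card {t : G.CSocket // G.dc t.1 = d} : ℝ≥0∞) / (Fintype.card G.CSocket : ℝ≥0∞)

variable {G}

/-- The binary linear code of a graph: each check node sees an even number of ones. -/
def code (σ : G.Graph) : Set (Fin G.n → ZMod 2) :=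
  {x | ∀ j : Fin G.m, ∑ k : Fin (G.dc j : ℕ), x (σ.symm ⟨j, k⟩).1 = 0}

/-- The other edges at the variable node of the edge `s`. -/
abbrev VNbr (s : G.VSocket) : Type := {s' : G.VSocket // s' ≠ s ∧ s'.1 = s.1}

/-- The other edges at the check node of the edge `s`. -/
abbrev CNbr (σ : G.Graph) (s : G.VSocket) : Type :=
  {s' : G.VSocket // s' ≠ s ∧ (σ s').1 = (σ s).1}

/-- The assignments of bits to the other edges at the check node of `s` that satisfy the parity
check when the edge `s` carries the bit `b`. -/
abbrev LocalConfig (σ : G.Graph) (s : G.VSocket) (b : ZMod 2) : Type :=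
  {x : CNbr σ s → ZMod 2 // ∑ s', x s' = b}

/-- Sum-product decoding: `spMsg W σ y l s` is the message (a function of the bit, defined up to a
common factor) that the variable node of the edge `s` sends along `s` after `l` iterations, when
`y` is received. The inner sum is the message that a check node sends along the edge `s'`. -/
def spMsg (W : MBIOSChannel) (σ : G.Graph) (y : Fin G.n → ℝ) :
    ℕ → G.VSocket → ZMod 2 → ℝ≥0
  | 0, s, b => W.f b (y s.1)
  | l + 1, s, b => W.f b (y s.1) *
      ∏ s' : VNbr s, ∑ x : LocalConfig σ s'.1 b,
        ∏ s'' : CNbr σ s'.1, spMsg W σ y l s''.1 (x.1 s'')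

/-- The cost `-log f(y|b)`, which is `+∞` where the density vanishes. -/
def cost (W : MBIOSChannel) (b : ZMod 2) (y : ℝ) : EReal :=
  -ENNReal.log (W.f b y : ℝ≥0∞)

/-- Min-sum decoding: the analogue of `spMsg` with costs, products of likelihoods being replaced by
sums of costs, and sums by minima. -/
def msMsg (W : MBIOSChannel) (σ : G.Graph) (y : Fin G.n → ℝ) :
    ℕ → G.VSocket → ZMod 2 → EReal
  | 0, s, b => cost W b (y s.1)
  | l + 1, s, b => cost W b (y s.1) +
      ∑ s' : VNbr s, ⨅ x : LocalConfig σ s'.1 b,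
        ∑ s'' : CNbr σ s'.1, msMsg W σ y l s''.1 (x.1 s'')

/-- The error weight of the sum-product estimate of a bit whose true value is `b`; ties are broken
by a fair coin. -/
def spErr (μ : ZMod 2 → ℝ≥0) (b : ZMod 2) : ℝ≥0∞ :=
  if μ b < μ (b + 1) then 1 else if μ b = μ (b + 1) then 2⁻¹ else 0

/-- The error weight of the min-sum estimate of a bit whose true value is `b`; a tie counts as an
error with weight `τ`. -/
def msErr (τ : ℝ≥0∞) (κ : ZMod 2 → EReal) (b : ZMod 2) : ℝ≥0∞ :=
  if κ (b + 1) < κ b then 1 else if κ (b + 1) = κ b then τ else 0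

/-- The average of `err σ y s` over a uniformly random graph `σ` of the ensemble, the channel output
`y` when the word `sent σ` is transmitted, and a uniformly random edge `s`. -/
def average (W : MBIOSChannel) (sent : G.Graph → Fin G.n → ZMod 2)
    (err : G.Graph → (Fin G.n → ℝ) → G.VSocket → ℝ≥0∞) : ℝ≥0∞ :=
  (∑ σ : G.Graph, ∑ s : G.VSocket,
      ∫⁻ y, err σ y s ∂(Measure.pi fun i => W.law (sent σ i))) /
    ((Fintype.card G.Graph : ℝ≥0∞) * (Fintype.card G.VSocket : ℝ≥0∞))

/-- Average bit error probability of sum-product decoding after `l` iterations. -/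
def spAverage (W : MBIOSChannel) (sent : G.Graph → Fin G.n → ZMod 2) (l : ℕ) : ℝ≥0∞ :=
  average W sent fun σ y s => spErr (spMsg W σ y l s) (sent σ s.1)

/-- Average bit error probability of min-sum decoding after `l` iterations. -/
def msAverage (W : MBIOSChannel) (τ : ℝ≥0∞) (sent : G.Graph → Fin G.n → ZMod 2) (l : ℕ) : ℝ≥0∞ :=
  average W sent fun σ y s => msErr τ (msMsg W σ y l s) (sent σ s.1)

end Ensemble

/-- The sequence `G` of finite ensembles realizes the `(λ, ρ)` ensemble: the codeword length tends
to infinity and the edge-perspective degree distributions tend to `λ` and `ρ`. -/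
structure Realizes (lam rho : PMF ℕ+) (G : ℕ → Ensemble) : Prop where
  length : Tendsto (fun k => (G k).n) atTop atTop
  var : ∀ d, Tendsto (fun k => (G k).varEdgeFraction d) atTop (𝓝 (lam d))
  chk : ∀ d, Tendsto (fun k => (G k).chkEdgeFraction d) atTop (𝓝 (rho d))

/-- `P` is the asymptotic average bit error probability, as the codeword length tends to infinity,
of the `(λ, ρ)` ensemble, where `avg G sent` is the average bit error probability of the finite
ensemble `G` when `sent σ` is transmitted with the graph `σ`. The limit has to be `P` for all
choices of the transmitted codewords (the all-zero word is one). -/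
def IsAsymptotic (lam rho : PMF ℕ+)
    (avg : (G : Ensemble) → (G.Graph → Fin G.n → ZMod 2) → ℝ≥0∞) (P : ℝ≥0∞) : Prop :=
  ∀ G : ℕ → Ensemble, Realizes lam rho G →
    ∀ sent : (k : ℕ) → (G k).Graph → Fin (G k).n → ZMod 2,
      (∀ k σ, sent k σ ∈ Ensemble.code σ) →
        Tendsto (fun k => avg (G k) (sent k)) atTop (𝓝 P)

end LDPC

end

/-!
The average error is determined by the local structure of a random graph. The message sent along an
edge after `l` iterations is a function of the computation tree of depth `l` of that edge
(`Ensemble.IsCompTree.likMsg_eq`), and both algorithms are covered by one recursion in the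
likelihood domain, in which a check node takes a sum (sum-product) or a maximum (min-sum, whose
costs are negative logarithms of likelihoods).

*Convergence.* A tree of shape `T` is embedded in a graph by choosing a socket for each of its
nodes. When the chosen nodes are distinct, a random bijection of `E` sockets realizes the `k` edges
of the tree with probability at least `E ^ (-k)` (`card_equiv_le`), and the edge together with the
graph determines the embedding (`Ensemble.IsCompTree.unique`). Hence the edges whose computation
tree has the shape `T` and distinct nodes make up at least the fraction `Ensemble.shapeFreq`, which
is the probability that independent random sockets have the right degrees and lie at distinct
nodes. It converges to the probability `Shape.prob` of `T` in a branching process, because nodes of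
bounded degree are rarely hit twice. On such edges the channel outputs are independent, and by the
symmetry of the channel the expected error is that of the all-zero word on the tree
(`lintegral_codeword_eq_treeErr`). So the limit inferior of the average of an error weight is at
least its expectation `limitErr` under the branching process. Since the probabilities of the shapes
add up to one (`Shape.tsum_prob`), the same bound for the complementary weight shows that the average
converges to `limitErr` (`isAsymptotic_limitErr`).

*Sum-product is at least as good as min-sum.* This holds on every tree (`treeErr_sum_le`). By
symmetry the transmitted word may be averaged over all codewords of the tree. The sum-product message
is then proportional to the posterior distribution of the root bit, and deciding for the larger
posterior minimizes the error.

*Bhattacharyya bound.* On a tree, the square root of the max-product likelihood ratio of a check node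
is at most the sum of those of its children: in a configuration of odd parity, flipping a bit that is
one gives a configuration of even parity. Along the tree this bounds the root of the likelihood ratio
by the multi-affine function `Shape.minSum` of the independent root likelihood ratios of the channel
outputs (`Shape.treeMsg_one_le`), each of mean `D`. An error or a tie means that the ratio is at
least one, so the error is at most `minSum` evaluated at `D` (`treeErr_maxAgg_le`), and the
expectation of this quantity over the branching process satisfies the recursion of `z`
(`Shape.tsum_prob_mul_minSum_le`).
-/

noncomputable section

namespace LDPC

/-! ### Message passing with a general aggregation rule -/

/-- The maximum of a finite family of likelihoods, the empty maximum being `0`. -/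
def maxAgg (s : Multiset ℝ≥0) : ℝ≥0 := s.sup

/-- The error weight of the estimate of a bit with true value `b` from the likelihoods `m`, ties
having weight `τ`. -/
def bitErr (τ : ℝ≥0∞) (m : ZMod 2 → ℝ≥0) (b : ZMod 2) : ℝ≥0∞ :=
  if m b < m (b + 1) then 1 else if m b = m (b + 1) then τ else 0

namespace Ensemble

variable {G : Ensemble}

/-- Message passing in the likelihood domain, `w i b` being the likelihood of the bit `b` at the
variable node `i`. A check node aggregates the likelihoods of the local configurations by `A`: the
sum gives sum-product decoding, the maximum gives min-sum decoding. -/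
def likMsg (A : Multiset ℝ≥0 → ℝ≥0) (σ : G.Graph) (w : Fin G.n → ZMod 2 → ℝ≥0) :
    ℕ → G.VSocket → ZMod 2 → ℝ≥0
  | 0, s, b => w s.1 b
  | l + 1, s, b => w s.1 b *
      ∏ s' : VNbr s, A (Finset.univ.val.map fun x : LocalConfig σ s'.1 b =>
        ∏ s'' : CNbr σ s'.1, likMsg A σ w l s''.1 (x.1 s''))

lemma spMsg_eq_likMsg (W : MBIOSChannel) (σ : G.Graph) (y : Fin G.n → ℝ) (l : ℕ) (s : G.VSocket)
    (b : ZMod 2) :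
    spMsg W σ y l s b = likMsg Multiset.sum σ (fun i b => W.f b (y i)) l s b := by
  induction l generalizing s b with
  | zero => rfl
  | succ l ih => simp only [spMsg, likMsg, ih]; rfl

lemma neg_log_mul (x y : ℝ≥0) :
    -ENNReal.log ((x * y : ℝ≥0) : ℝ≥0∞) = -ENNReal.log x + -ENNReal.log y := by
  rw [ENNReal.coe_mul, ENNReal.log_mul_add, EReal.neg_add, sub_eq_add_neg]
  · exact Or.inr (by simp)
  · exact Or.inl (by simp)

lemma neg_log_prod {ι : Type*} (s : Finset ι) (g : ι → ℝ≥0) :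
    -ENNReal.log ((∏ i ∈ s, g i : ℝ≥0) : ℝ≥0∞) = ∑ i ∈ s, -ENNReal.log (g i) := by
  classical
  induction s using Finset.induction_on with
  | empty => simp
  | insert a s ha ih => rw [Finset.prod_insert ha, Finset.sum_insert ha, neg_log_mul, ih]

lemma neg_log_lt_neg_log_iff (x y : ℝ≥0) :
    -ENNReal.log (x : ℝ≥0∞) < -ENNReal.log (y : ℝ≥0∞) ↔ y < x := by
  rw [EReal.neg_lt_neg_iff, ENNReal.log_lt_log_iff, ENNReal.coe_lt_coe]

lemma neg_log_eq_neg_log_iff (x y : ℝ≥0) :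
    -ENNReal.log (x : ℝ≥0∞) = -ENNReal.log (y : ℝ≥0∞) ↔ x = y := by
  rw [neg_inj, ENNReal.log_eq_iff, ENNReal.coe_inj]

lemma neg_log_maxAgg {ι : Type*} [Fintype ι] (g : ι → ℝ≥0) :
    -ENNReal.log ((maxAgg (Finset.univ.val.map g) : ℝ≥0) : ℝ≥0∞) =
      ⨅ i, -ENNReal.log (g i) := by
  have h : maxAgg (Finset.univ.val.map g) = Finset.univ.sup g := rfl
  rw [h]
  apply le_antisymm
  · refine le_iInf fun i => ?_
    rw [EReal.neg_le_neg_iff, ENNReal.log_le_log_iff, ENNReal.coe_le_coe]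
    exact Finset.le_sup (Finset.mem_univ i)
  · rcases isEmpty_or_nonempty ι with hι | hι
    · simp
    · obtain ⟨i, -, hi⟩ := Finset.exists_mem_eq_sup Finset.univ Finset.univ_nonempty g
      rw [hi]
      exact iInf_le (fun i => -ENNReal.log (g i : ℝ≥0∞)) i

/-- Min-sum costs are the negative logarithms of max-product likelihoods. -/
lemma msMsg_eq_neg_log_likMsg (W : MBIOSChannel) (σ : G.Graph) (y : Fin G.n → ℝ) (l : ℕ)
    (s : G.VSocket) (b : ZMod 2) :
    msMsg W σ y l s b =
      -ENNReal.log (likMsg maxAgg σ (fun i b => W.f b (y i)) l s b : ℝ≥0) := by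
  induction l generalizing s b with
  | zero => rfl
  | succ l ih => simp only [msMsg, likMsg, ih, neg_log_mul, neg_log_prod, neg_log_maxAgg]; rfl

lemma spErr_eq_bitErr : spErr = bitErr 2⁻¹ := rfl

lemma msErr_neg_log (τ : ℝ≥0∞) (m : ZMod 2 → ℝ≥0) (b : ZMod 2) :
    msErr τ (fun b => -ENNReal.log (m b : ℝ≥0∞)) b = bitErr τ m b := by
  simp only [msErr, bitErr, neg_log_lt_neg_log_iff, neg_log_eq_neg_log_iff, eq_comm]

end Ensemble

/-! ### Sockets of a node -/

section Other

variable {ι : Type*} {D : ι → ℕ+}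

/-- The `k`-th of the sockets other than `s` at the node of `s`, in increasing order (and `s` itself
when there are not that many). -/
def other (s : (i : ι) × Fin (D i : ℕ)) (k : ℕ) : (i : ι) × Fin (D i : ℕ) :=
  ⟨s.1, if h : (if k < s.2 then k else k + 1) < D s.1 then ⟨_, h⟩ else s.2⟩

@[simp] lemma other_fst (s : (i : ι) × Fin (D i : ℕ)) (k : ℕ) : (other s k).1 = s.1 := rfl

lemma other_snd (s : (i : ι) × Fin (D i : ℕ)) {k : ℕ} (hk : k + 1 < (D s.1 : ℕ)) :
    ((other s k).2 : ℕ) = if k < s.2 then k else k + 1 := by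
  have h : (if k < (s.2 : ℕ) then k else k + 1) < D s.1 := by split_ifs <;> omega
  simp only [other, h, dif_pos]

lemma other_ne (s : (i : ι) × Fin (D i : ℕ)) {k : ℕ} (hk : k + 1 < D s.1) : other s k ≠ s := by
  intro h
  have h1 := other_snd s hk
  rw [h] at h1
  split_ifs at h1 <;> omega

lemma other_inj (s : (i : ι) × Fin (D i : ℕ)) {k k' : ℕ} (hk : k + 1 < D s.1)
    (hk' : k' + 1 < D s.1) (h : other s k = other s k') : k = k' := by
  have h1 := other_snd s hk
  rw [h, other_snd s hk'] at h1
  split_ifs at h1 <;> omega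

lemma exists_other_eq (s s' : (i : ι) × Fin (D i : ℕ)) (hne : s' ≠ s) (h : s'.1 = s.1) :
    ∃ k : ℕ, k + 1 < (D s.1 : ℕ) ∧ other s k = s' := by
  obtain ⟨i, j⟩ := s
  obtain ⟨i', j'⟩ := s'
  dsimp only at h
  subst h
  have hj : (j' : ℕ) ≠ j := fun h => hne (by rw [Fin.ext h])
  have key : ∀ k : ℕ, k + 1 < D i' → (if k < (j : ℕ) then k else k + 1) = j' →
      other (⟨i', j⟩ : (i : ι) × Fin (D i : ℕ)) k = ⟨i', j'⟩ := by
    intro k hk e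
    have h1 := other_snd (⟨i', j⟩ : (i : ι) × Fin (D i : ℕ)) (k := k) hk
    refine Sigma.ext rfl (heq_of_eq (Fin.ext ?_))
    rw [h1]
    exact e
  rcases lt_or_gt_of_ne hj with h | h
  · exact ⟨j', by have := j.2; simp only; omega, key _ (by have := j.2; omega) (by simp [h])⟩
  · refine ⟨j' - 1, by have := j'.2; simp only; omega, key _ (by have := j'.2; omega) ?_⟩
    rw [if_neg (by omega)]
    omega

/-- The enumeration of the other sockets at the node of `s`. -/
def otherEquiv (s : (i : ι) × Fin (D i : ℕ)) {d : ℕ} (hd : (D s.1 : ℕ) = d + 1) :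
    Fin d ≃ {s' : (i : ι) × Fin (D i : ℕ) // s' ≠ s ∧ s'.1 = s.1} :=
  Equiv.ofBijective
    (fun k => ⟨other s k, other_ne s (by omega), rfl⟩)
    ⟨fun k k' h => Fin.ext (other_inj s (by omega) (by omega) (congrArg Subtype.val h)),
      fun s' => by
        obtain ⟨k, hk, h⟩ := exists_other_eq s s'.1 s'.2.1 s'.2.2
        exact ⟨⟨k, by omega⟩, Subtype.ext h⟩⟩

lemma sum_socket_eq {M : Type*} [AddCommMonoid M] (s : (i : ι) × Fin (D i : ℕ)) {d : ℕ}
    (hd : (D s.1 : ℕ) = d + 1) (g : (i : ι) × Fin (D i : ℕ) → M) :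
    ∑ k : Fin (D s.1 : ℕ), g ⟨s.1, k⟩ = g s + ∑ k : Fin d, g (other s k) := by
  classical
  rw [Fintype.sum_eq_add_sum_compl s.2]
  congr 1
  symm
  refine Finset.sum_bij (fun k _ => (other s k).2) ?_ ?_ ?_ ?_
  · intro k _
    exact Finset.mem_compl.2 fun h =>
      other_ne s (k := k) (by omega) (Sigma.ext rfl (heq_of_eq (Finset.mem_singleton.1 h)))
  · intro k _ k' _ h
    exact Fin.ext (other_inj s (by omega) (by omega) (Sigma.ext rfl (heq_of_eq h)))
  · intro j hj
    simp only [Finset.mem_compl, Finset.mem_singleton] at hj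
    obtain ⟨k, hk, h⟩ := exists_other_eq s ⟨s.1, j⟩
      (fun h => hj (eq_of_heq (Sigma.ext_iff.1 h).2)) rfl
    exact ⟨⟨k, by omega⟩, Finset.mem_univ _, eq_of_heq (Sigma.ext_iff.1 h).2⟩
  · intro k _
    rfl

end Other

/-! ### Shapes of computation trees -/

/-- The shapes of the computation trees of depth `l`. A variable node has `d` child check nodes and
hence degree `d + 1`, the parent edge included; its `i`-th child has `e i` child variable nodes,
which are the roots of trees of depth `l - 1`. At depth `0` only the degree of the root is
recorded. -/
inductive Shape : ℕ → Type
  | leaf (d : ℕ) : Shape 0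
  | node {l : ℕ} (d : ℕ) (e : Fin d → ℕ) (c : (i : Fin d) → Fin (e i) → Shape l) : Shape (l + 1)

namespace Shape

/-- The variable nodes of a tree, other than the root. -/
def Inner : {l : ℕ} → Shape l → Type
  | _, .leaf _ => Empty
  | _, .node d e c => (i : Fin d) × (j : Fin (e i)) × Option (Inner (c i j))

/-- The variable nodes of a tree, the root being `none`. -/
abbrev Var {l : ℕ} (T : Shape l) : Type := Option T.Inner

/-- The check nodes of a tree. The check nodes below the root are the elements `⟨i, none⟩`. -/
def Chk : {l : ℕ} → Shape l → Type
  | _, .leaf _ => Empty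
  | _, .node d e c => (i : Fin d) × Option ((j : Fin (e i)) × Chk (c i j))

instance finite_inner : ∀ {l : ℕ} (T : Shape l), Finite T.Inner
  | _, .leaf _ => inferInstanceAs (Finite Empty)
  | _, .node d e c =>
    have : ∀ i j, Finite (c i j).Inner := fun _ _ => finite_inner _
    inferInstanceAs (Finite ((i : Fin d) × (j : Fin (e i)) × Option (c i j).Inner))

instance finite_chk : ∀ {l : ℕ} (T : Shape l), Finite T.Chk
  | _, .leaf _ => inferInstanceAs (Finite Empty)
  | _, .node d e c =>
    have : ∀ i j, Finite (c i j).Chk := fun _ _ => finite_chk _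
    inferInstanceAs (Finite ((i : Fin d) × Option ((j : Fin (e i)) × (c i j).Chk)))

instance {l : ℕ} (T : Shape l) : Fintype T.Inner := Fintype.ofFinite _

instance {l : ℕ} (T : Shape l) : Fintype T.Chk := Fintype.ofFinite _

section Node

variable {l d : ℕ} {e : Fin d → ℕ} {c : (i : Fin d) → Fin (e i) → Shape l}

/-- The inclusion of the variable nodes of a subtree. -/
def inner (i : Fin d) (j : Fin (e i)) (v : (c i j).Var) : (node d e c).Inner := ⟨i, j, v⟩

/-- The inclusion of the variable nodes of a subtree, as nodes of the whole tree. -/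
def down (i : Fin d) (j : Fin (e i)) (v : (c i j).Var) : (node d e c).Var := some (inner i j v)

/-- The inclusion of the check nodes of a subtree. -/
def downChk (i : Fin d) (j : Fin (e i)) (q : (c i j).Chk) : (node d e c).Chk := ⟨i, some ⟨j, q⟩⟩

/-- The check nodes below the root. -/
def topChk (i : Fin d) : (node d e c).Chk := ⟨i, none⟩

lemma var_cases {P : (node d e c).Var → Prop} (h : P none) (h' : ∀ i j v, P (down i j v)) :
    ∀ v, P v
  | none => h
  | some ⟨i, j, v⟩ => h' i j v

lemma chk_cases {P : (node d e c).Chk → Prop} (h : ∀ i, P (topChk i))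
    (h' : ∀ i j q, P (downChk i j q)) : ∀ q, P q
  | ⟨i, none⟩ => h i
  | ⟨i, some ⟨j, q⟩⟩ => h' i j q

lemma prod_var {M : Type*} [CommMonoid M] (g : (node d e c).Var → M) :
    ∏ v, g v = g none * ∏ i, ∏ j, ∏ v, g (down i j v) := by
  rw [Fintype.prod_option]
  congr 1
  have h : ∀ g' : ((i : Fin d) × (j : Fin (e i)) × Option (c i j).Inner) → M,
      ∏ x, g' x = ∏ i, ∏ j, ∏ v, g' ⟨i, j, v⟩ := by
    intro g'
    rw [Fintype.prod_sigma]
    simp_rw [Fintype.prod_sigma]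
  refine Eq.trans ?_ (h fun x => g (some x))
  let E : (node d e c).Inner ≃ ((i : Fin d) × (j : Fin (e i)) × Option (c i j).Inner) :=
    Equiv.refl _
  exact Fintype.prod_equiv E _ _ fun _ => rfl

lemma prod_chk {M : Type*} [CommMonoid M] (g : (node d e c).Chk → M) :
    ∏ q, g q = ∏ i, (g (topChk i) * ∏ j, ∏ q, g (downChk i j q)) := by
  have h : ∀ g' : ((i : Fin d) × Option ((j : Fin (e i)) × (c i j).Chk)) → M,
      ∏ x, g' x = ∏ i, (g' ⟨i, none⟩ * ∏ j, ∏ q, g' ⟨i, some ⟨j, q⟩⟩) := by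
    intro g'
    rw [Fintype.prod_sigma]
    refine Finset.prod_congr rfl fun i _ => ?_
    rw [Fintype.prod_option, Fintype.prod_sigma]
  refine Eq.trans ?_ (h g)
  let E : (node d e c).Chk ≃ ((i : Fin d) × Option ((j : Fin (e i)) × (c i j).Chk)) := Equiv.refl _
  exact Fintype.prod_equiv E _ _ fun _ => rfl

end Node

lemma prod_var_leaf {M : Type*} [CommMonoid M] {d : ℕ} (g : (leaf d).Var → M) :
    ∏ v, g v = g none := by
  have : IsEmpty (leaf d).Inner := inferInstanceAs (IsEmpty Empty)
  rw [Fintype.prod_option]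
  simp

lemma prod_chk_leaf {M : Type*} [CommMonoid M] {d : ℕ} (g : (leaf d).Chk → M) :
    ∏ q, g q = 1 := by
  have : IsEmpty (leaf d).Chk := inferInstanceAs (IsEmpty Empty)
  simp

/-- The number of children of a variable node (at depth `0`, the recorded number). -/
def varDeg : {l : ℕ} → (T : Shape l) → T.Var → ℕ
  | _, .leaf d => fun _ => d
  | _, .node d e c => fun v : Option ((i : Fin d) × (j : Fin (e i)) × Option (c i j).Inner) =>
    v.elim d fun x => varDeg (c x.1 x.2.1) x.2.2

/-- The number of children of a check node. -/
def chkDeg : {l : ℕ} → (T : Shape l) → T.Chk → ℕ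
  | _, .leaf _ => Empty.elim
  | _, .node d e c => fun q : (i : Fin d) × Option ((j : Fin (e i)) × (c i j).Chk) =>
    q.2.elim (e q.1) fun x => chkDeg (c q.1 x.1) x.2

/-- The parent of a check node, and the position of the check node among its children. -/
def chkParent : {l : ℕ} → (T : Shape l) → T.Chk → T.Var × ℕ
  | _, .leaf _ => Empty.elim
  | _, .node d e c => fun q : (i : Fin d) × Option ((j : Fin (e i)) × (c i j).Chk) =>
    q.2.elim (none, q.1) fun x =>
      (down q.1 x.1 (chkParent (c q.1 x.1) x.2).1, (chkParent (c q.1 x.1) x.2).2)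

/-- The parent of a variable node, and the position of the variable node among its children. -/
def varParent : {l : ℕ} → (T : Shape l) → T.Inner → T.Chk × ℕ
  | _, .leaf _ => Empty.elim
  | _, .node d e c => fun v : (i : Fin d) × (j : Fin (e i)) × Option (c i j).Inner =>
    v.2.2.elim (topChk v.1, v.2.1) fun x =>
      (downChk v.1 v.2.1 (varParent (c v.1 v.2.1) x).1, (varParent (c v.1 v.2.1) x).2)

lemma chkParent_lt : ∀ {l : ℕ} (T : Shape l) (q : T.Chk),
    (T.chkParent q).2 < T.varDeg (T.chkParent q).1
  | _, .leaf _ => fun q => q.elim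
  | _, .node _ _ c => by
    rintro ⟨i, _ | ⟨j, q⟩⟩
    · exact i.2
    · exact chkParent_lt (c i j) q

lemma varParent_lt : ∀ {l : ℕ} (T : Shape l) (v : T.Inner),
    (T.varParent v).2 < T.chkDeg (T.varParent v).1
  | _, .leaf _ => fun v => v.elim
  | _, .node _ _ c => by
    rintro ⟨i, j, _ | v⟩
    · exact j.2
    · exact varParent_lt (c i j) v

lemma down_inj {l d : ℕ} {e : Fin d → ℕ} {c : (i : Fin d) → Fin (e i) → Shape l} {i i' : Fin d}
    {j : Fin (e i)} {j' : Fin (e i')} {v : (c i j).Var} {v' : (c i' j').Var}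
    (h : (down i j v : (node d e c).Var) = down i' j' v') :
    (⟨⟨i, j⟩, v⟩ : (p : (i : Fin d) × Fin (e i)) × (c p.1 p.2).Var) = ⟨⟨i', j'⟩, v'⟩ := by
  unfold down at h
  injection h with h
  injection h with h1 h2
  subst h1
  injection eq_of_heq h2 with h3 h4
  subst h3
  rw [eq_of_heq h4]

lemma downChk_inj {l d : ℕ} {e : Fin d → ℕ} {c : (i : Fin d) → Fin (e i) → Shape l} {i i' : Fin d}
    {j : Fin (e i)} {j' : Fin (e i')} {q : (c i j).Chk} {q' : (c i' j').Chk}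
    (h : (downChk i j q : (node d e c).Chk) = downChk i' j' q') :
    (⟨⟨i, j⟩, q⟩ : (p : (i : Fin d) × Fin (e i)) × (c p.1 p.2).Chk) = ⟨⟨i', j'⟩, q'⟩ := by
  unfold downChk at h
  injection h with h1 h2
  subst h1
  injection eq_of_heq h2 with h2
  injection h2 with h3 h4
  subst h3
  rw [eq_of_heq h4]

lemma chkParent_injective : ∀ {l : ℕ} (T : Shape l), Function.Injective T.chkParent
  | _, .leaf _ => fun q => q.elim
  | _, .node d e c => by
    have ih := fun i j => chkParent_injective (c i j)
    rintro ⟨i, _ | ⟨j, q⟩⟩ ⟨i', _ | ⟨j', q'⟩⟩ h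
    · exact congrArg (topChk (c := c)) (Fin.ext (Prod.ext_iff.1 h).2)
    · exact absurd (Prod.ext_iff.1 h).1 (Option.some_ne_none _).symm
    · exact absurd (Prod.ext_iff.1 h).1 (Option.some_ne_none _)
    · obtain ⟨h1, h2⟩ := Prod.ext_iff.1 h
      have h3 := down_inj h1
      injection h3 with h4 h5
      injection h4 with h6 h7
      subst h6
      cases h7
      exact congrArg (downChk (c := c) i j) (ih i j (Prod.ext (eq_of_heq h5) h2))

lemma varParent_injective : ∀ {l : ℕ} (T : Shape l), Function.Injective T.varParent
  | _, .leaf _ => fun q => q.elim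
  | _, .node d e c => by
    have ih := fun i j => varParent_injective (c i j)
    rintro ⟨i, j, _ | v⟩ ⟨i', j', _ | v'⟩ h <;> obtain ⟨h1, h2⟩ := Prod.ext_iff.1 h
    · obtain ⟨h3, -⟩ := Sigma.ext_iff.1 h1
      obtain rfl : i = i' := h3
      exact congrArg (fun j => inner (c := c) i j none) (Fin.ext h2)
    · obtain ⟨h3, h4⟩ := Sigma.ext_iff.1 h1
      obtain rfl : i = i' := h3
      exact absurd (eq_of_heq h4) (Option.some_ne_none _).symm
    · obtain ⟨h3, h4⟩ := Sigma.ext_iff.1 h1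
      obtain rfl : i = i' := h3
      exact absurd (eq_of_heq h4) (Option.some_ne_none _)
    · have h3 := downChk_inj h1
      injection h3 with h4 h5
      injection h4 with h6 h7
      subst h6
      cases h7
      exact congrArg (inner (c := c) i j) (congrArg some (ih i j (Prod.ext (eq_of_heq h5) h2)))

/-! ### Messages and codewords on trees -/

/-- The message at the root of a tree, `w v b` being the likelihood of the bit `b` at the variable
node `v`. -/
def treeMsg (A : Multiset ℝ≥0 → ℝ≥0) :
    {l : ℕ} → (T : Shape l) → (T.Var → ZMod 2 → ℝ≥0) → ZMod 2 → ℝ≥0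
  | _, .leaf _, w, b => w none b
  | _, .node _ e c, w, b => w none b *
      ∏ i, A (Finset.univ.val.map fun x : {x : Fin (e i) → ZMod 2 // ∑ j, x j = b} =>
        ∏ j, treeMsg A (c i j) (fun v => w (down i j v)) (x.1 j))

/-- The codewords of a tree: each check node sees an even number of ones. -/
def IsCodeword : {l : ℕ} → (T : Shape l) → (T.Var → ZMod 2) → Prop
  | _, .leaf _, _ => True
  | _, .node _ _ c, x => ∀ i, x none = ∑ j, x (down i j none) ∧
      ∀ j, IsCodeword (c i j) fun v => x (down i j v)

lemma agg_congr (A : Multiset ℝ≥0 → ℝ≥0) {α β : Type*} [Fintype α] [Fintype β] (E : α ≃ β)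
    (g : α → ℝ≥0) (g' : β → ℝ≥0) (h : ∀ x, g x = g' (E x)) :
    A (Finset.univ.val.map g) = A (Finset.univ.val.map g') := by
  have h1 : g = g' ∘ E := funext h
  rw [h1, ← Multiset.map_map, Multiset.map_univ_val_equiv]

/-- Adding a codeword to the channel inputs shifts the message at the root by the bit of the
root. -/
lemma treeMsg_add_codeword (A : Multiset ℝ≥0 → ℝ≥0) : ∀ {l : ℕ} (T : Shape l)
    (w : T.Var → ZMod 2 → ℝ≥0) (x : T.Var → ZMod 2), T.IsCodeword x → ∀ b,
    T.treeMsg A (fun v b => w v (b + x v)) b = T.treeMsg A w (b + x none)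
  | _, .leaf _, _, _, _, _ => rfl
  | _, .node d e c, w, x, hx, b => by
    simp only [treeMsg]
    congr 1
    refine Finset.prod_congr rfl fun i _ => ?_
    have hE : ∀ z : Fin (e i) → ZMod 2, ∑ j, z j = b ↔
        ∑ j, (Equiv.addRight fun j => x (down i j none) : Equiv.Perm (Fin (e i) → ZMod 2)) z j
          = b + x none := by
      intro z
      simp only [Equiv.coe_addRight, Pi.add_apply, Finset.sum_add_distrib, ← (hx i).1]
      exact (add_left_inj _).symm
    refine agg_congr A (Equiv.subtypeEquiv (Equiv.addRight fun j => x (down i j none)) hE)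
      _ _ fun z => ?_
    refine Finset.prod_congr rfl fun j _ => ?_
    exact treeMsg_add_codeword A (c i j) (fun v => w (down i j v)) _ ((hx i).2 j) _

end Shape

/-! ### Computation trees of a graph -/

namespace Ensemble

variable {G : Ensemble}

open Shape

/-- The computation tree of depth `l` of the edge `a none` in the graph `σ` has the shape `T`, and
its nodes are entered through the sockets `a` and `t`. -/
def IsCompTree (σ : G.Graph) :
    {l : ℕ} → (T : Shape l) → (T.Var → G.VSocket) → (T.Chk → G.CSocket) → Prop
  | _, .leaf d, a, _ => (G.dv (a none).1 : ℕ) = d + 1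
  | _, .node d e c, a, t => (G.dv (a none).1 : ℕ) = d + 1 ∧ ∀ i : Fin d,
      σ (other (a none) i) = t (topChk i) ∧ (G.dc (t (topChk i)).1 : ℕ) = e i + 1 ∧
      ∀ j : Fin (e i), σ (a (down i j none)) = other (t (topChk i)) j ∧
        IsCompTree σ (c i j) (fun v => a (down i j v)) fun q => t (downChk i j q)

/-- The recursive description of a computation tree follows from the conditions on degrees and
edges, node by node. -/
lemma isCompTree_of_forall (σ : G.Graph) : ∀ {l : ℕ} (T : Shape l) (a : T.Var → G.VSocket)
    (t : T.Chk → G.CSocket), (∀ v, (G.dv (a v).1 : ℕ) = T.varDeg v + 1) →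
    (∀ q, (G.dc (t q).1 : ℕ) = T.chkDeg q + 1) →
    (∀ q, σ (other (a (T.chkParent q).1) (T.chkParent q).2) = t q) →
    (∀ v, σ (a (some v)) = other (t (T.varParent v).1) (T.varParent v).2) →
    IsCompTree σ T a t
  | _, .leaf _, _, _, h1, _, _, _ => h1 none
  | _, .node _ _ c, a, t, h1, h2, h3, h4 => by
    refine ⟨h1 none, fun i => ⟨h3 (topChk i), h2 (topChk i), fun j => ⟨?_, ?_⟩⟩⟩
    · exact h4 (inner i j none)
    · exact isCompTree_of_forall σ (c i j) _ _ (fun v => h1 (down i j v))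
        (fun q => h2 (downChk i j q)) (fun q => h3 (downChk i j q))
        fun v => h4 (inner i j (some v))

/-- The computation tree of an edge is unique. -/
lemma IsCompTree.unique {σ : G.Graph} : ∀ {l : ℕ} {T T' : Shape l} {a : T.Var → G.VSocket}
    {t : T.Chk → G.CSocket} {a' : T'.Var → G.VSocket} {t' : T'.Chk → G.CSocket},
    IsCompTree σ T a t → IsCompTree σ T' a' t' → a none = a' none →
    (⟨T, a, t⟩ : (T : Shape l) × (T.Var → G.VSocket) × (T.Chk → G.CSocket)) = ⟨T', a', t'⟩
  | _, .leaf d, .leaf d', a, t, a', t', h, h', hr => by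
    simp only [IsCompTree] at h h'
    rw [hr, h'] at h
    obtain rfl : d = d' := by omega
    obtain rfl : a = a' := by
      funext v
      rcases v with _ | v
      · exact hr
      · exact v.elim
    obtain rfl : t = t' := by
      funext q
      exact q.elim
    rfl
  | _, .node d e c, .node d' e' c', a, t, a', t', h, h', hr => by
    obtain ⟨h1, h2⟩ := h
    obtain ⟨h1', h2'⟩ := h'
    rw [hr, h1'] at h1
    obtain rfl : d = d' := by omega
    have ht : ∀ i, t (topChk i) = t' (topChk i) := fun i => by
      rw [← (h2 i).1, ← (h2' i).1, hr]
    obtain rfl : e = e' := by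
      funext i
      have h3 := (h2 i).2.1
      rw [ht i, (h2' i).2.1] at h3
      omega
    have key := fun i j => IsCompTree.unique ((h2 i).2.2 j).2 ((h2' i).2.2 j).2 <| by
      apply σ.injective
      rw [((h2 i).2.2 j).1, ((h2' i).2.2 j).1, ht i]
    obtain rfl : c = c' := by
      funext i j
      exact (Sigma.ext_iff.1 (key i j)).1
    have key' := fun i j => eq_of_heq (Sigma.ext_iff.1 (key i j)).2
    obtain rfl : a = a' := by
      funext v
      revert v
      exact var_cases hr fun i j v => congrFun (congrArg Prod.fst (key' i j)) v
    obtain rfl : t = t' := by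
      funext q
      revert q
      exact chk_cases ht fun i j q => congrFun (congrArg Prod.snd (key' i j)) q
    rfl

/-- The other edges at the check node of `s`. -/
def cnbrEquiv (σ : G.Graph) (s : G.VSocket) {e : ℕ} (he : (G.dc (σ s).1 : ℕ) = e + 1) :
    Fin e ≃ CNbr σ s :=
  (otherEquiv (σ s) he).trans
    (Equiv.subtypeEquiv σ.symm fun t => by
      rw [σ.apply_symm_apply, ne_eq, ne_eq, σ.symm_apply_eq])

/-- The message along an edge is computed from its computation tree. -/
lemma IsCompTree.likMsg_eq (A : Multiset ℝ≥0 → ℝ≥0) {σ : G.Graph} (w : Fin G.n → ZMod 2 → ℝ≥0) :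
    ∀ {l : ℕ} {T : Shape l} {a : T.Var → G.VSocket} {t : T.Chk → G.CSocket},
    IsCompTree σ T a t → ∀ b, likMsg A σ w l (a none) b = T.treeMsg A (fun v => w (a v).1) b
  | _, .leaf _, _, _, _, _ => rfl
  | _, .node d e c, a, t, h, b => by
    obtain ⟨h1, h2⟩ := h
    simp only [likMsg, treeMsg]
    congr 1
    symm
    refine Fintype.prod_equiv (otherEquiv (a none) h1) _ _ fun i => ?_
    have hs : σ (otherEquiv (a none) h1 i).1 = t (topChk i) := (h2 i).1
    have he : (G.dc (σ (otherEquiv (a none) h1 i).1).1 : ℕ) = e i + 1 := by rw [hs, (h2 i).2.1]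
    let E := cnbrEquiv σ _ he
    have hE : ∀ j, (E j).1 = a (down i j none) := fun j => by
      have h3 := ((h2 i).2.2 j).1
      rw [← σ.symm_apply_eq.2 h3.symm, ← hs]
      rfl
    refine agg_congr A (Equiv.subtypeEquiv (Equiv.arrowCongr E (Equiv.refl _)) fun z => ?_)
      _ _ fun z => ?_
    · rw [Fintype.sum_equiv E z (Equiv.arrowCongr E (Equiv.refl _) z) fun j =>
        (congrArg z (E.symm_apply_apply j)).symm]
    · refine Fintype.prod_equiv E _ _ fun j => ?_
      rw [hE j, IsCompTree.likMsg_eq A w ((h2 i).2.2 j).2]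
      exact congrArg (treeMsg A (c i j) _) (congrArg z.1 (E.symm_apply_apply j)).symm

lemma IsCompTree.isCodeword {σ : G.Graph} {x : Fin G.n → ZMod 2} (hx : x ∈ code σ) :
    ∀ {l : ℕ} {T : Shape l} {a : T.Var → G.VSocket} {t : T.Chk → G.CSocket},
    IsCompTree σ T a t → T.IsCodeword fun v => x (a v).1
  | _, .leaf _, _, _, _ => trivial
  | _, .node d e c, a, t, h => by
    obtain ⟨h1, h2⟩ := h
    refine fun i => ⟨?_, fun j => IsCompTree.isCodeword hx ((h2 i).2.2 j).2⟩
    have h3 := hx (t (topChk i)).1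
    rw [sum_socket_eq (t (topChk i)) (h2 i).2.1 fun s => x (σ.symm s).1, ← (h2 i).1,
      σ.symm_apply_apply, other_fst] at h3
    dsimp only
    rw [eq_neg_of_add_eq_zero_left h3, ZMod.neg_eq_self_mod_two]
    refine Finset.sum_congr rfl fun j _ => ?_
    rw [(h2 i).1, ← ((h2 i).2.2 j).1, σ.symm_apply_apply]

end Ensemble

/-! ### Counting bijections and labelings -/

/-- A uniformly random bijection of two sets of size `E` extends a given partial injection of size
`k` with probability at least `E ^ (-k)`. -/
lemma card_equiv_le {α β κ : Type*} [Finite α] [Finite β] [Finite κ] (u : κ → α) (w : κ → β)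
    (hu : Function.Injective u) (hw : Function.Injective w) :
    Nat.card (α ≃ β) ≤
      Nat.card β ^ Nat.card κ * Nat.card {σ : α ≃ β // ∀ k, σ (u k) = w k} := by
  have hπ : ∀ σ : α ≃ β, ∃ π : Equiv.Perm β, ∀ k, π (σ (u k)) = w k := fun σ => by
    obtain ⟨π, hπ⟩ := Equiv.Perm.exists_extending_pair (fun k => σ (u k)) w
      (σ.injective.comp hu) hw
    exact ⟨π, hπ⟩
  -- The permutation is a function of the images of the `u k` alone, which makes `F` injective.
  have hπ' : ∀ v : κ → β, ∃ π : Equiv.Perm β, ∀ σ : α ≃ β, (∀ k, σ (u k) = v k) →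
      ∀ k, π (σ (u k)) = w k := fun v => by
    by_cases h : ∃ σ : α ≃ β, ∀ k, σ (u k) = v k
    · obtain ⟨σ, hσ⟩ := h
      obtain ⟨π, hπ⟩ := hπ σ
      exact ⟨π, fun σ' hσ' k => by rw [hσ' k, ← hσ k, hπ k]⟩
    · exact ⟨1, fun σ hσ => (h ⟨σ, hσ⟩).elim⟩
  choose π hπ using hπ'
  let F : (α ≃ β) → (κ → β) × {σ : α ≃ β // ∀ k, σ (u k) = w k} := fun σ =>
    (fun k => σ (u k), ⟨σ.trans (π fun k => σ (u k)), fun k => hπ _ σ (fun _ => rfl) k⟩)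
  have hF : Function.Injective F := by
    intro σ σ' h
    obtain ⟨h1, h2⟩ := Prod.ext_iff.1 h
    have h1 : (fun k => σ (u k)) = fun k => σ' (u k) := h1
    have h2 : σ.trans (π fun k => σ (u k)) = σ'.trans (π fun k => σ' (u k)) :=
      congrArg Subtype.val h2
    rw [h1] at h2
    ext x
    exact (π _).injective (Equiv.congr_fun h2 x)
  have := Nat.card_le_card_of_injective F hF
  rwa [Nat.card_prod, Nat.card_fun] at this

/-- The assignments of sockets to the elements of `κ`, at distinct nodes of the degrees
`δ v + 1`. -/
abbrev Labeling {ι κ : Type*} (D : ι → ℕ+) (δ : κ → ℕ) : Type _ :=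
  {a : κ → (i : ι) × Fin (D i : ℕ) //
    (∀ v, D (a v).1 = (δ v).succPNat) ∧ Function.Injective fun v => (a v).1}

section Labeling

variable {ι κ : Type*} [Finite ι] [Finite κ] (D : ι → ℕ+) (δ : κ → ℕ)

lemma card_labeling_le [Fintype κ] :
    Nat.card (Labeling D δ) ≤
      ∏ v, Nat.card {s : (i : ι) × Fin (D i : ℕ) // D s.1 = (δ v).succPNat} := by
  rw [← Nat.card_pi]
  refine Nat.card_le_card_of_injective (fun a v => ⟨a.1 v, a.2.1 v⟩) fun a a' h => ?_
  exact Subtype.ext (funext fun v => congrArg Subtype.val (congrFun h v))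

/-- The labelings with a repeated node, at which a bounded number of sockets is available, are few. -/
lemma prod_card_le_card_labeling_add [Fintype κ] {M : ℕ} (hM : ∀ v, δ v < M) :
    ∏ v, Nat.card {s : (i : ι) × Fin (D i : ℕ) // D s.1 = (δ v).succPNat} ≤
      Nat.card (Labeling D δ) + (Fintype.card κ) ^ 2 *
        (Nat.card ((i : ι) × Fin (D i : ℕ)) ^ (Fintype.card κ - 1) * M) := by
  classical
  rw [← Nat.card_pi]
  set S := (i : ι) × Fin (D i : ℕ)
  let L := (v : κ) → {s : S // D s.1 = (δ v).succPNat}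
  let R := (p : κ × κ) × (({v : κ // v ≠ p.2} → S) × Fin M)
  have hex : ∀ a : L, (¬ Function.Injective fun v => (a v).1.1) →
      ∃ p : κ × κ, p.1 ≠ p.2 ∧ (a p.1).1.1 = (a p.2).1.1 := fun a h => by
    simp only [Function.Injective, not_forall] at h
    obtain ⟨v, v', h, hne⟩ := h
    exact ⟨(v, v'), hne, h⟩
  choose p hp using hex
  have hlt : ∀ (a : L) (v : κ), ((a v).1.2 : ℕ) < M := fun a v => by
    have h1 := (a v).1.2.2
    have h2 : (D (a v).1.1 : ℕ) = δ v + 1 := by rw [(a v).2]; rfl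
    have h3 := hM v
    omega
  let F : L → Labeling D δ ⊕ R := fun a =>
    if h : Function.Injective fun v => (a v).1.1 then
      Sum.inl ⟨fun v => (a v).1, fun v => (a v).2, h⟩
    else Sum.inr ⟨p a h, fun v => (a v.1).1, ⟨(a (p a h).2).1.2, hlt a _⟩⟩
  have hF : Function.Injective F := by
    intro a a' h
    by_cases h1 : Function.Injective fun v => (a v).1.1 <;>
    by_cases h2 : Function.Injective fun v => (a' v).1.1 <;>
    simp only [F, h1, h2, dif_pos, dif_neg, not_false_eq_true, reduceCtorEq, Sum.inl.injEq,
      Subtype.mk.injEq, Sum.inr.injEq] at h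
    · funext v
      exact Subtype.ext (congrFun h v)
    · obtain ⟨h3, h4⟩ := Sigma.ext_iff.1 h
      dsimp only at h3 h4
      have hp1 := hp a h1
      have hp2 := hp a' h2
      rw [← h3] at h4 hp2
      obtain ⟨h5, h6⟩ := Prod.ext_iff.1 (eq_of_heq h4)
      have h7 : ∀ v, v ≠ (p a h1).2 → (a v).1 = (a' v).1 := fun v hv => congrFun h5 ⟨v, hv⟩
      funext v
      apply Subtype.ext
      by_cases hv : v = (p a h1).2
      · subst hv
        have h8 : (a (p a h1).2).1.1 = (a' (p a h1).2).1.1 := by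
          rw [← hp1.2, ← hp2.2, h7 _ hp1.1]
        have h9 : ((a (p a h1).2).1.2 : ℕ) = (a' (p a h1).2).1.2 := Fin.ext_iff.1 h6
        refine Sigma.ext h8 ?_
        rw [Fin.heq_ext_iff (by rw [h8])]
        exact h9
      · exact h7 v hv
  have := Nat.card_le_card_of_injective F hF
  refine this.trans ?_
  rw [Nat.card_sum]
  refine Nat.add_le_add_left ?_ _
  rw [Nat.card_sigma]
  have hq : ∀ q : κ × κ, Nat.card (({v : κ // v ≠ q.2} → S) × Fin M) =
      Nat.card S ^ (Fintype.card κ - 1) * M := fun q => by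
    rw [Nat.card_prod, Nat.card_fun, Nat.card_eq_fintype_card (α := Fin M), Fintype.card_fin,
      Nat.card_eq_fintype_card (α := {v : κ // v ≠ q.2}), Fintype.card_subtype_compl,
      Fintype.card_subtype_eq]
  simp only [hq, Finset.sum_const, Finset.card_univ, Fintype.card_prod, smul_eq_mul, sq]
  exact le_rfl

end Labeling

/-- If the fractions of sockets at nodes of the various degrees converge to `p` and the number of
sockets grows, then independent uniformly random sockets form a labeling of degrees `δ` with
probability tending to `∏ v, p (δ v + 1)`. -/
lemma tendsto_card_labeling {κ : Type*} [Fintype κ] (δ : κ → ℕ) {ι : ℕ → Type*}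
    [∀ k, Fintype (ι k)] (D : (k : ℕ) → ι k → ℕ+) (p : ℕ+ → ℝ≥0∞) (hp : ∀ d, p d ≠ ∞)
    (hE : Tendsto (fun k => Nat.card ((i : ι k) × Fin (D k i : ℕ))) atTop atTop)
    (h : ∀ d, Tendsto (fun k => (Nat.card {s : (i : ι k) × Fin (D k i : ℕ) // D k s.1 = d} : ℝ≥0∞) /
      (Nat.card ((i : ι k) × Fin (D k i : ℕ)) : ℝ≥0∞)) atTop (𝓝 (p d))) :
    Tendsto (fun k => (Nat.card (Labeling (D k) δ) : ℝ≥0∞) /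
      (Nat.card ((i : ι k) × Fin (D k i : ℕ)) : ℝ≥0∞) ^ Fintype.card κ) atTop
      (𝓝 (∏ v, p (δ v).succPNat)) := by
  set E : ℕ → ℕ := fun k => Nat.card ((i : ι k) × Fin (D k i : ℕ))
  set N : ℕ → ℕ+ → ℕ := fun k d => Nat.card {s : (i : ι k) × Fin (D k i : ℕ) // D k s.1 = d}
  have hup : Tendsto (fun k => ∏ v, ((N k (δ v).succPNat : ℝ≥0∞) / (E k : ℝ≥0∞))) atTop
      (𝓝 (∏ v, p (δ v).succPNat)) := by
    refine ENNReal.tendsto_finsetProd_of_ne_top _ (fun v _ => h _) (fun v _ => hp _)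
  have hprod : ∀ k, ∏ v, ((N k (δ v).succPNat : ℝ≥0∞) / (E k : ℝ≥0∞)) =
      ((∏ v, N k (δ v).succPNat : ℕ) : ℝ≥0∞) / (E k : ℝ≥0∞) ^ Fintype.card κ := by
    intro k
    simp only [div_eq_mul_inv]
    rw [Finset.prod_mul_distrib, Finset.prod_const, Finset.card_univ, ENNReal.inv_pow]
    push_cast
    rfl
  obtain ⟨M, hM⟩ : ∃ M, ∀ v, δ v < M :=
    ⟨Finset.univ.sup δ + 1, fun v => Nat.lt_succ_of_le (Finset.le_sup (Finset.mem_univ v))⟩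
  set C : ℝ≥0∞ := (Fintype.card κ : ℝ≥0∞) ^ 2 * M
  have herr : Tendsto (fun k => C / (E k : ℝ≥0∞)) atTop (𝓝 0) := by
    have h1 : Tendsto (fun k => (E k : ℝ≥0∞)) atTop (𝓝 ∞) :=
      ENNReal.tendsto_nat_nhds_top.comp hE
    have := ENNReal.Tendsto.const_div (a := C) h1 (Or.inr (by finiteness))
    simpa using this
  have hlow : Tendsto (fun k => ∏ v, ((N k (δ v).succPNat : ℝ≥0∞) / (E k : ℝ≥0∞)) -
      C / (E k : ℝ≥0∞)) atTop (𝓝 (∏ v, p (δ v).succPNat)) := by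
    have := ENNReal.Tendsto.sub hup herr (Or.inr (by simp))
    simpa using this
  refine tendsto_of_tendsto_of_tendsto_of_le_of_le' hlow hup ?_ ?_
  · filter_upwards [hE.eventually_ge_atTop 1] with k hk
    have hk0 : (E k : ℝ≥0∞) ≠ 0 := by
      have : E k ≠ 0 := by omega
      exact_mod_cast this
    have hkt : (E k : ℝ≥0∞) ≠ ∞ := ENNReal.natCast_ne_top _
    rw [tsub_le_iff_right, hprod]
    rcases isEmpty_or_nonempty κ with hκ | hκ
    · have h1 : Nat.card (Labeling (D k) δ) = 1 := by
        have : Unique (Labeling (D k) δ) :=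
          { default := ⟨fun v => isEmptyElim v, fun v => isEmptyElim v, fun v => isEmptyElim v⟩
            uniq := fun a => Subtype.ext (funext fun v => isEmptyElim v) }
        exact Nat.card_unique
      simp [h1]
    · have h2 := prod_card_le_card_labeling_add (D k) δ hM
      have h3 : ((∏ v, N k (δ v).succPNat : ℕ) : ℝ≥0∞) ≤ Nat.card (Labeling (D k) δ) +
          C * (E k : ℝ≥0∞) ^ (Fintype.card κ - 1) := by
        refine (Nat.cast_le.2 h2).trans_eq ?_
        push_cast
        simp only [C, E]
        ring
      have hcard : Fintype.card κ = Fintype.card κ - 1 + 1 :=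
        (Nat.succ_pred_eq_of_pos Fintype.card_pos).symm
      refine (ENNReal.div_le_div_right h3 _).trans ?_
      rw [ENNReal.add_div]
      refine add_le_add le_rfl (le_of_eq ?_)
      conv_lhs => rw [hcard]
      rw [Nat.add_sub_cancel, pow_succ, mul_comm C, ENNReal.mul_div_mul_left _ _
        (pow_ne_zero _ hk0) (ENNReal.pow_ne_top hkt)]
  · refine Eventually.of_forall fun k => ?_
    rw [hprod]
    exact ENNReal.div_le_div_right (Nat.cast_le.2 (card_labeling_le (D k) δ)) _

namespace Ensemble

variable {G : Ensemble}

/-- The edges of a tree embedded with distinct nodes form a partial injection from the variable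
sockets to the check sockets, which a random graph extends with probability at least
`E ^ (-k)`. -/
lemma card_graph_le_card_isCompTree {l : ℕ} (T : Shape l)
    (a : Labeling G.dv T.varDeg) (t : Labeling G.dc T.chkDeg) :
    Nat.card G.Graph ≤ Nat.card G.CSocket ^ (Nat.card T.Chk + Nat.card T.Inner) *
      Nat.card {σ : G.Graph // IsCompTree σ T a.1 t.1} := by
  have ha : ∀ v, (G.dv (a.1 v).1 : ℕ) = T.varDeg v + 1 := fun v => by rw [a.2.1 v]; rfl
  have ht : ∀ q, (G.dc (t.1 q).1 : ℕ) = T.chkDeg q + 1 := fun q => by rw [t.2.1 q]; rfl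
  have hP : ∀ q, (T.chkParent q).2 + 1 < (G.dv (a.1 (T.chkParent q).1).1 : ℕ) := fun q => by
    rw [ha]
    exact Nat.succ_lt_succ (T.chkParent_lt q)
  have hQ : ∀ v, (T.varParent v).2 + 1 < (G.dc (t.1 (T.varParent v).1).1 : ℕ) := fun v => by
    rw [ht]
    exact Nat.succ_lt_succ (T.varParent_lt v)
  let u : T.Chk ⊕ T.Inner → G.VSocket :=
    Sum.elim (fun q => other (a.1 (T.chkParent q).1) (T.chkParent q).2) fun v => a.1 (some v)
  let w : T.Chk ⊕ T.Inner → G.CSocket :=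
    Sum.elim t.1 fun v => other (t.1 (T.varParent v).1) (T.varParent v).2
  have hu : Function.Injective u := by
    refine Function.Injective.sumElim (fun q q' h => ?_) (fun v v' h => ?_) fun q v h => ?_
    · have h0 := congrArg Sigma.fst h
      have h1 : (T.chkParent q).1 = (T.chkParent q').1 := a.2.2 h0
      have h2 := hP q'
      rw [← h1] at h h2
      exact T.chkParent_injective (Prod.ext h1 (other_inj _ (hP q) h2 h))
    · have h0 := congrArg Sigma.fst h
      exact Option.some_injective _ (a.2.2 h0)
    · have h0 := congrArg Sigma.fst h
      have h1 : (T.chkParent q).1 = some v := a.2.2 h0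
      rw [← h1] at h
      exact other_ne _ (hP q) h
  have hw : Function.Injective w := by
    refine Function.Injective.sumElim (fun q q' h => ?_) (fun v v' h => ?_) fun q v h => ?_
    · have h0 := congrArg Sigma.fst h
      exact t.2.2 h0
    · have h0 := congrArg Sigma.fst h
      have h1 : (T.varParent v).1 = (T.varParent v').1 := t.2.2 h0
      have h2 := hQ v'
      rw [← h1] at h h2
      exact T.varParent_injective (Prod.ext h1 (other_inj _ (hQ v) h2 h))
    · have h0 := congrArg Sigma.fst h
      have h1 : q = (T.varParent v).1 := t.2.2 h0
      rw [h1] at h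
      exact other_ne _ (hQ v) h.symm
  refine (card_equiv_le u w hu hw).trans ?_
  rw [Nat.card_sum]
  refine Nat.mul_le_mul_left _ ?_
  exact Nat.card_le_card_of_injective (Subtype.map id fun σ hσ =>
    isCompTree_of_forall σ T a.1 t.1 ha ht (fun q => hσ (Sum.inl q)) fun v => hσ (Sum.inr v))
    (Subtype.map_injective _ Function.injective_id)

end Ensemble

/-! ### The channel -/

namespace MBIOSChannel

variable (W : MBIOSChannel)

instance (b : ZMod 2) : IsProbabilityMeasure (W.law b) :=
  ⟨by rw [law, withDensity_apply _ MeasurableSet.univ, Measure.restrict_univ, W.lintegral_f]⟩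

/-- Changing the channel input by `x` amounts to this transformation of the channel output. -/
def flip (x : ZMod 2) : ℝ ≃ᵐ ℝ := if x = 0 then MeasurableEquiv.refl ℝ else MeasurableEquiv.neg ℝ

lemma f_flip (x b : ZMod 2) (y : ℝ) : W.f b (flip x y) = W.f (b + x) y := by
  have h01 := W.symm
  have h10 : ∀ y, W.f 1 y = W.f 0 (-y) := fun y => by rw [W.symm, neg_neg]
  have hx : x = 0 ∨ x = 1 := by revert x; decide
  have hb : b = 0 ∨ b = 1 := by revert b; decide
  have h2 : (1 + 1 : ZMod 2) = 0 := by decide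
  rcases hx with rfl | rfl
  · simp [flip]
  · rcases hb with rfl | rfl
    · simp [flip, h10]
    · simp [flip, h2, h01]

lemma law_eq_map_flip (x : ZMod 2) : W.law x = (W.law 0).map (flip x) := by
  have hx : x = 0 ∨ x = 1 := by revert x; decide
  have hmp : MeasurePreserving (flip x) W.ref W.ref := by
    refine ⟨(flip x).measurable, ?_⟩
    rcases hx with rfl | rfl
    · rw [flip, if_pos rfl]
      exact Measure.map_id
    · have h := W.ref_neg
      simpa [flip] using h
  ext s hs
  rw [(flip x).map_apply, law, law, withDensity_apply _ hs,
    withDensity_apply _ ((flip x).measurable hs),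
    ← hmp.setLIntegral_comp_preimage hs (W.measurable_f x).coe_nnreal_ennreal]
  refine lintegral_congr fun y => ?_
  have h2 : ∀ x : ZMod 2, x + x = 0 := by decide
  simp only [f_flip, h2]

end MBIOSChannel

/-- The law of the coordinates with indices `g v`, for distinct indices `g v`. -/
lemma map_pi_comp_injective {ι κ : Type*} [Fintype ι] [Fintype κ] (μ : ι → Measure ℝ)
    [∀ i, IsProbabilityMeasure (μ i)] {g : κ → ι} (hg : Function.Injective g) :
    (Measure.pi μ).map (fun y v => y (g v)) = Measure.pi fun v => μ (g v) := by
  have h : ProbabilityTheory.iIndepFun (fun i (y : ι → ℝ) => y i) (Measure.pi μ) :=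
    ProbabilityTheory.iIndepFun_pi (X := fun _ => id) fun i => aemeasurable_id
  have h1 := (ProbabilityTheory.iIndepFun_iff_map_fun_eq_pi_map
    (fun v => (measurable_pi_apply (g v)).aemeasurable)).1 (h.precomp hg)
  rw [h1]
  congr 1
  funext v
  exact (measurePreserving_eval μ (g v)).map_eq

/-! ### Errors on trees and errors in the ensemble -/

/-- An error weight `err m b` of the estimate of a bit with true value `b` from the likelihoods `m`
that does not depend on the labeling of the two bits. -/
def IsEquivariant (err : (ZMod 2 → ℝ≥0) → ZMod 2 → ℝ≥0∞) : Prop :=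
  ∀ m x b, err (fun b => m (b + x)) b = err m (b + x)

lemma isEquivariant_bitErr (τ : ℝ≥0∞) : IsEquivariant (bitErr τ) := fun m x b => by
  simp only [bitErr, add_right_comm b 1 x]

/-- The expected error weight at the root of a tree when the zero word is transmitted. -/
def treeErr (W : MBIOSChannel) (A : Multiset ℝ≥0 → ℝ≥0) (err : (ZMod 2 → ℝ≥0) → ZMod 2 → ℝ≥0∞)
    {l : ℕ} (T : Shape l) : ℝ≥0∞ :=
  ∫⁻ y, err (T.treeMsg A fun v b => W.f b (y v)) 0 ∂(Measure.pi fun _ : T.Var => W.law 0)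

/-- The expected error weight does not depend on the transmitted codeword. -/
lemma lintegral_codeword_eq_treeErr (W : MBIOSChannel) (A : Multiset ℝ≥0 → ℝ≥0)
    {err : (ZMod 2 → ℝ≥0) → ZMod 2 → ℝ≥0∞} (herr : IsEquivariant err) {l : ℕ} (T : Shape l)
    {x : T.Var → ZMod 2} (hx : T.IsCodeword x) :
    ∫⁻ y, err (T.treeMsg A fun v b => W.f b (y v)) (x none) ∂(Measure.pi fun v => W.law (x v)) =
      treeErr W A err T := by
  have h1 : (Measure.pi fun v => W.law (x v)) = (Measure.pi fun _ : T.Var => W.law 0).map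
      (MeasurableEquiv.piCongrRight fun v => MBIOSChannel.flip (x v)) := by
    have h := Measure.pi_map_pi (μ := fun _ : T.Var => W.law 0)
      (f := fun v => MBIOSChannel.flip (x v))
      (fun v => (MBIOSChannel.flip (x v)).measurable.aemeasurable)
    simp only [← W.law_eq_map_flip] at h
    exact h.symm
  rw [h1, lintegral_map_equiv]
  refine lintegral_congr fun y => ?_
  have h2 : (fun b => T.treeMsg A (fun v b => W.f b
      ((MeasurableEquiv.piCongrRight fun v => MBIOSChannel.flip (x v)) y v)) b) =
      fun b => T.treeMsg A (fun v b => W.f b (y v)) (b + x none) := by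
    funext b
    rw [← T.treeMsg_add_codeword A (fun v b => W.f b (y v)) x hx b]
    congr 1
    funext v b
    exact W.f_flip (x v) b (y v)
  have h3 : ∀ x : ZMod 2, x + x = 0 := by decide
  have h4 := herr (T.treeMsg A fun v b => W.f b (y v)) (x none) (x none)
  rw [h3] at h4
  rw [← h4, ← h2]

namespace Ensemble

variable {G : Ensemble}

lemma treeErr_le_lintegral (W : MBIOSChannel) (A : Multiset ℝ≥0 → ℝ≥0)
    {err : (ZMod 2 → ℝ≥0) → ZMod 2 → ℝ≥0∞} (herr : IsEquivariant err) {σ : G.Graph}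
    {x : Fin G.n → ZMod 2} (hx : x ∈ code σ) {l : ℕ} {T : Shape l} {a : T.Var → G.VSocket}
    {t : T.Chk → G.CSocket} (hT : IsCompTree σ T a t) (ha : Function.Injective fun v => (a v).1) :
    treeErr W A err T ≤ ∫⁻ y, err (likMsg A σ (fun i b => W.f b (y i)) l (a none)) (x (a none).1)
      ∂(Measure.pi fun i => W.law (x i)) := by
  rw [← lintegral_codeword_eq_treeErr W A herr T (hT.isCodeword hx),
    ← map_pi_comp_injective (fun i => W.law (x i)) ha]
  refine (lintegral_map_le _ _).trans_eq (lintegral_congr fun y => ?_)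
  congr 1
  funext b
  exact (hT.likMsg_eq A (fun i b => W.f b (y i)) b).symm

/-- The probability that independent uniformly random sockets, one for each node of `T`, lie at
distinct nodes of the degrees prescribed by `T`. -/
def shapeFreq (G : Ensemble) {l : ℕ} (T : Shape l) : ℝ≥0∞ :=
  (Nat.card (Labeling G.dv T.varDeg) : ℝ≥0∞) / (Nat.card G.VSocket : ℝ≥0∞) ^ Fintype.card T.Var *
    ((Nat.card (Labeling G.dc T.chkDeg) : ℝ≥0∞) /
      (Nat.card G.CSocket : ℝ≥0∞) ^ Fintype.card T.Chk)

lemma card_vsocket_eq (G : Ensemble) : Nat.card G.VSocket = Nat.card G.CSocket := by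
  simp [Nat.card_eq_fintype_card, Fintype.card_sigma, G.sum_eq]

/-- The edges whose computation tree has distinct nodes already contribute this much to the average
error. -/
lemma sum_treeErr_mul_shapeFreq_le_average (W : MBIOSChannel) (A : Multiset ℝ≥0 → ℝ≥0)
    {err : (ZMod 2 → ℝ≥0) → ZMod 2 → ℝ≥0∞} (herr : IsEquivariant err)
    (hG : Nat.card G.VSocket ≠ 0)
    {sent : G.Graph → Fin G.n → ZMod 2} (hsent : ∀ σ, sent σ ∈ code σ) {l : ℕ}
    (S : Finset (Shape l)) :
    ∑ T ∈ S, treeErr W A err T * G.shapeFreq T ≤ average W sent fun σ y s =>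
      err (likMsg A σ (fun i b => W.f b (y i)) l s) (sent σ s.1) := by
  classical
  set I : G.Graph × G.VSocket → ℝ≥0∞ := fun x =>
    ∫⁻ y, err (likMsg A x.1 (fun i b => W.f b (y i)) l x.2) (sent x.1 x.2.1)
      ∂(Measure.pi fun i => W.law (sent x.1 i)) with hI
  obtain ⟨E, hE⟩ : ∃ E : ℝ≥0∞, E = (Nat.card G.VSocket : ℝ≥0∞) := ⟨_, rfl⟩
  have hE0 : E ≠ 0 := by rw [hE]; exact_mod_cast hG
  have hEt : E ≠ ∞ := by rw [hE]; exact ENNReal.natCast_ne_top _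
  have hg0 : (Nat.card G.Graph : ℝ≥0∞) ≠ 0 := by
    have : Nonempty G.Graph := by
      have h := G.card_vsocket_eq
      rw [Nat.card_eq_fintype_card, Nat.card_eq_fintype_card] at h
      exact ⟨Fintype.equivOfCardEq h⟩
    exact_mod_cast Nat.card_pos.ne'
  have hgt : (Nat.card G.Graph : ℝ≥0∞) ≠ ∞ := ENNReal.natCast_ne_top _
  let P (T : Shape l) := Labeling G.dv T.varDeg × Labeling G.dc T.chkDeg
  let J := (T : S) × (p : P T.1) × {σ : G.Graph // IsCompTree σ T.1 p.1.1 p.2.1}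
  let F : J → G.Graph × G.VSocket := fun j => (j.2.2.1, j.2.1.1.1 none)
  have hF : Function.Injective F := by
    rintro ⟨⟨T, hT⟩, ⟨⟨a, ha⟩, ⟨t, ht⟩⟩, ⟨σ, h⟩⟩ ⟨⟨T', hT'⟩, ⟨⟨a', ha'⟩, ⟨t', ht'⟩⟩, ⟨σ', h'⟩⟩ hF
    obtain ⟨h1, h2⟩ := Prod.ext_iff.1 hF
    obtain rfl : σ = σ' := h1
    have h3 := h.unique h' h2
    injection h3 with h4 h5
    subst h4
    injection eq_of_heq h5 with h6 h7
    subst h6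
    subst h7
    rfl
  have hle : ∀ j : J, treeErr W A err j.1.1 ≤ I (F j) := fun j =>
    treeErr_le_lintegral W A herr (hsent _) j.2.2.2 j.2.1.1.2.2
  have hsum : ∑' j : J, treeErr W A err j.1.1 ≤ ∑ σ : G.Graph, ∑ s : G.VSocket, I (σ, s) := by
    refine (ENNReal.tsum_le_tsum hle).trans ((ENNReal.tsum_comp_le_tsum_of_injective hF I).trans ?_)
    rw [tsum_fintype, Fintype.sum_prod_type]
  have hJ : ∑' j : J, treeErr W A err j.1.1 = ∑ T ∈ S, ∑' p : P T,
      (Nat.card {σ : G.Graph // IsCompTree σ T p.1.1 p.2.1} : ℝ≥0∞) * treeErr W A err T := by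
    rw [ENNReal.tsum_sigma', tsum_fintype, ← Finset.sum_coe_sort S]
    refine Finset.sum_congr rfl fun T _ => ?_
    rw [ENNReal.tsum_sigma']
    refine tsum_congr fun p => ?_
    dsimp only
    rw [tsum_fintype, Finset.sum_const, nsmul_eq_mul, Finset.card_univ, Nat.card_eq_fintype_card]
  rw [average, ← Nat.card_eq_fintype_card, ← Nat.card_eq_fintype_card, ← hE,
    ENNReal.le_div_iff_mul_le (Or.inl (mul_ne_zero hg0 hE0)) (Or.inl (ENNReal.mul_ne_top hgt hEt))]
  refine le_trans ?_ hsum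
  rw [hJ, Finset.sum_mul]
  refine Finset.sum_le_sum fun T _ => ?_
  have hcount : ∀ p : P T, (Nat.card G.Graph : ℝ≥0∞) / E ^ (Nat.card T.Chk + Nat.card T.Inner) ≤
      Nat.card {σ : G.Graph // IsCompTree σ T p.1.1 p.2.1} := fun p => by
    refine ENNReal.div_le_of_le_mul' ?_
    have := card_graph_le_card_isCompTree T p.1 p.2
    rw [← G.card_vsocket_eq] at this
    rw [hE]
    exact_mod_cast this
  calc treeErr W A err T * G.shapeFreq T * (Nat.card G.Graph * E)
      = ∑' _ : P T, (Nat.card G.Graph : ℝ≥0∞) / E ^ (Nat.card T.Chk + Nat.card T.Inner) *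
          treeErr W A err T := by
        have : Fintype (P T) := Fintype.ofFinite _
        rw [tsum_fintype, Finset.sum_const, nsmul_eq_mul, Finset.card_univ,
          ← Nat.card_eq_fintype_card, Nat.card_prod, shapeFreq, ← G.card_vsocket_eq,
          Fintype.card_option, ← hE, Nat.card_eq_fintype_card (α := T.Chk),
          Nat.card_eq_fintype_card (α := T.Inner), 
          pow_add E (Fintype.card T.Chk), pow_succ E (Fintype.card T.Inner)]
        have h1 : E ^ Fintype.card T.Chk ≠ 0 := pow_ne_zero _ hE0
        have h2 : E ^ Fintype.card T.Inner ≠ 0 := pow_ne_zero _ hE0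
        have h3 : E ^ Fintype.card T.Chk ≠ ∞ := ENNReal.pow_ne_top hEt
        have h4 : E ^ Fintype.card T.Inner ≠ ∞ := ENNReal.pow_ne_top hEt
        simp only [div_eq_mul_inv]
        rw [ENNReal.mul_inv (Or.inl h2) (Or.inl h4), ENNReal.mul_inv (Or.inl h1) (Or.inl h3)]
        push_cast
        calc _ = treeErr W A err T * ((Nat.card (Labeling G.dv T.varDeg) : ℝ≥0∞) *
              ((E ^ Fintype.card T.Inner)⁻¹) * ((Nat.card (Labeling G.dc T.chkDeg) : ℝ≥0∞) *
              (E ^ Fintype.card T.Chk)⁻¹)) * Nat.card G.Graph * (E⁻¹ * E) := by ring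
          _ = _ := by rw [ENNReal.inv_mul_cancel hE0 hEt]; ring
    _ ≤ _ := ENNReal.tsum_le_tsum fun p => by gcongr; exact hcount p

end Ensemble

/-! ### The branching process of computation trees -/

lemma tsum_pi_prod {α : Type*} {n : ℕ} (g : Fin n → α → ℝ≥0∞) :
    ∑' x : Fin n → α, ∏ i, g i (x i) = ∏ i, ∑' a, g i a := by
  induction n with
  | zero => simp
  | succ n ih =>
    rw [← (Fin.consEquiv fun _ => α).tsum_eq, ENNReal.tsum_prod', Fin.prod_univ_succ,
      ← ENNReal.tsum_mul_right]
    refine tsum_congr fun a => ?_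
    rw [← ih, ← ENNReal.tsum_mul_left]
    refine tsum_congr fun x => ?_
    simp [Fin.consEquiv, Fin.prod_univ_succ]

namespace Shape

/-- A tree of positive depth, as the family of the subtrees below its root. -/
def nodeEquiv (l : ℕ) : ((d : ℕ) × (Fin d → (e : ℕ) × (Fin e → Shape l))) ≃ Shape (l + 1) where
  toFun x := node x.1 (fun i => (x.2 i).1) fun i => (x.2 i).2
  invFun
    | node d e c => ⟨d, fun i => ⟨e i, c i⟩⟩
  left_inv _ := rfl
  right_inv
    | node _ _ _ => rfl

/-- A tree of depth zero, as the degree recorded at its root. -/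
def leafEquiv : ℕ ≃ Shape 0 where
  toFun := leaf
  invFun
    | leaf d => d
  left_inv _ := rfl
  right_inv
    | leaf _ => rfl

/-- The probability that the computation tree of an edge has a given shape, when the degrees of its
nodes are independent with the edge-perspective distributions. -/
def prob (lam rho : PMF ℕ+) {l : ℕ} (T : Shape l) : ℝ≥0∞ :=
  (∏ v, lam (T.varDeg v).succPNat) * ∏ q, rho (T.chkDeg q).succPNat

variable (lam rho : PMF ℕ+)

lemma prob_leaf (d : ℕ) : (leaf d).prob lam rho = lam d.succPNat := by
  rw [prob, prod_var_leaf, prod_chk_leaf, mul_one]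
  rfl

lemma prob_node {l d : ℕ} (e : Fin d → ℕ) (c : (i : Fin d) → Fin (e i) → Shape l) :
    (node d e c).prob lam rho =
      lam d.succPNat * ∏ i, (rho (e i).succPNat * ∏ j, (c i j).prob lam rho) := by
  rw [prob, prod_var, prod_chk]
  simp only [prob, Finset.prod_mul_distrib, mul_assoc]
  congr 1
  rw [mul_left_comm]
  rfl

lemma tsum_node {l : ℕ} (F : Shape (l + 1) → ℝ≥0∞) (w : ℕ → ℝ≥0∞)
    (g : (e : ℕ) → (Fin e → Shape l) → ℝ≥0∞)
    (hF : ∀ d e c, F (node d e c) = w d * ∏ i, g (e i) (c i)) :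
    ∑' T, F T = ∑' d, w d * (∑' e, ∑' c, g e c) ^ d := by
  rw [← (nodeEquiv l).tsum_eq, ENNReal.tsum_sigma']
  refine tsum_congr fun d => ?_
  have h : ∀ x : Fin d → (e : ℕ) × (Fin e → Shape l),
      F (nodeEquiv l ⟨d, x⟩) = w d * ∏ i, g (x i).1 (x i).2 := fun x => hF _ _ _
  simp only [h]
  rw [ENNReal.tsum_mul_left, tsum_pi_prod fun _ (x : (e : ℕ) × (Fin e → Shape l)) => g x.1 x.2,
    Finset.prod_const, Finset.card_univ, Fintype.card_fin, ENNReal.tsum_sigma']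

lemma tsum_succPNat (p : ℕ+ → ℝ≥0∞) : ∑' d : ℕ, p d.succPNat = ∑' i, p i :=
  Equiv.pnatEquivNat.symm.tsum_eq p

lemma tsum_prob (l : ℕ) : ∑' T : Shape l, T.prob lam rho = 1 := by
  induction l with
  | zero =>
    rw [← leafEquiv.tsum_eq]
    simp only [leafEquiv, Equiv.coe_fn_mk, prob_leaf]
    rw [tsum_succPNat lam, lam.tsum_coe]
  | succ l ih =>
    rw [tsum_node _ (fun d => lam d.succPNat)
      (fun e c => rho e.succPNat * ∏ j, (c j).prob lam rho) fun d e c => prob_node lam rho e c]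
    have h : ∑' e : ℕ, ∑' c : Fin e → Shape l, rho e.succPNat * ∏ j, (c j).prob lam rho = 1 := by
      simp only [ENNReal.tsum_mul_left, tsum_pi_prod fun _ (T : Shape l) => T.prob lam rho, ih,
        Finset.prod_const_one, mul_one]
      rw [tsum_succPNat rho, rho.tsum_coe]
    simp only [h, one_pow, mul_one]
    rw [tsum_succPNat lam, lam.tsum_coe]

/-- The sum, over the subtrees in which each variable node keeps all its children and each check
node keeps exactly one, of the product of the weights `r` of the variable nodes. These subtrees are
the supports of the minimal codewords whose root bit is one. -/
def minSum {R : Type*} [CommSemiring R] : {l : ℕ} → (T : Shape l) → (T.Var → R) → R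
  | _, .leaf _, r => r none
  | _, .node _ _ c, r => r none * ∏ i, ∑ j, minSum (c i j) fun v => r (down i j v)

/-- The expectation of `minSum` over the branching process satisfies the recursion of `zSeq`, up to
a factor `D ≤ 1` in each step. -/
lemma tsum_prob_mul_minSum_le {D : ℝ≥0∞} (hD : D ≤ 1) (l : ℕ) :
    ∑' T : Shape l, T.prob lam rho * T.minSum (fun _ => D) ≤ zSeq lam rho D l := by
  induction l with
  | zero =>
    rw [← leafEquiv.tsum_eq]
    simp only [leafEquiv, Equiv.coe_fn_mk, prob_leaf, minSum, ENNReal.tsum_mul_right]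
    rw [tsum_succPNat lam, lam.tsum_coe, one_mul]
    exact le_rfl
  | succ l ih =>
    have hnode : ∀ d e (c : (i : Fin d) → Fin (e i) → Shape l),
        (node d e c).prob lam rho * (node d e c).minSum (fun _ => D) =
          (lam d.succPNat * D) * ∏ i, ((rho (e i).succPNat * ∏ j, (c i j).prob lam rho) *
            ∑ j, (c i j).minSum fun _ => D) := fun d e c => by
      rw [prob_node, minSum, Finset.prod_mul_distrib (g := fun i => ∑ j, _)]
      ring
    rw [tsum_node _ _ (fun e c => (rho e.succPNat * ∏ j, (c j).prob lam rho) *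
            ∑ j, (c j).minSum fun _ => D) hnode]
    have hc : ∀ (e : ℕ) (k : Fin e), ∑' c : Fin e → Shape l,
        (∏ j, (c j).prob lam rho) * ((c k).minSum fun _ => D) =
          ∑' T : Shape l, T.prob lam rho * T.minSum (fun _ => D) := by
      intro e k
      have h := tsum_pi_prod fun (j : Fin e) (T : Shape l) =>
        T.prob lam rho * if j = k then T.minSum (fun _ => D) else 1
      simp only [Finset.prod_mul_distrib, Finset.prod_ite_eq', Finset.mem_univ, if_true] at h
      rw [h, Finset.prod_eq_single k _ (by simp)]
      · simp
      · intro j _ hj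
        simp only [hj, if_false, mul_one, tsum_prob]
    have h1 : ∑' (e : ℕ) (c : Fin e → Shape l), (rho e.succPNat * ∏ j, (c j).prob lam rho) *
        ∑ j, (c j).minSum (fun _ => D) =
        degreeSeriesDeriv rho 1 * ∑' T : Shape l, T.prob lam rho * T.minSum fun _ => D := by
      rw [degreeSeriesDeriv, ← ENNReal.tsum_mul_right, ← tsum_succPNat]
      refine tsum_congr fun e => ?_
      simp only [mul_assoc]
      rw [ENNReal.tsum_mul_left]
      simp only [Finset.mul_sum]
      rw [Summable.tsum_finsetSum fun _ _ => ENNReal.summable]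
      simp only [hc, Finset.sum_const, Finset.card_univ, Fintype.card_fin, nsmul_eq_mul,
        Nat.succPNat_coe, Nat.succ_eq_add_one, Nat.add_sub_cancel, one_pow, one_mul]
      ring
    rw [h1, zSeq, degreeSeries, ← tsum_succPNat]
    refine ENNReal.tsum_le_tsum fun d => ?_
    simp only [Nat.succPNat_coe, Nat.succ_eq_add_one, Nat.add_sub_cancel]
    gcongr
    exact mul_le_of_le_one_right zero_le hD

end Shape

/-! ### Convergence of the average error -/

lemma Realizes.tendsto_card_vsocket {lam rho : PMF ℕ+} {G : ℕ → Ensemble}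
    (h : Realizes lam rho G) : Tendsto (fun k => Nat.card (G k).VSocket) atTop atTop := by
  refine tendsto_atTop_mono (fun k => ?_) h.length
  rw [Nat.card_eq_fintype_card, Fintype.card_sigma]
  simp only [Fintype.card_fin]
  calc (G k).n = ∑ _i : Fin (G k).n, 1 := by simp
    _ ≤ _ := Finset.sum_le_sum fun i _ => ((G k).dv i).pos

lemma Realizes.tendsto_shapeFreq {lam rho : PMF ℕ+} {G : ℕ → Ensemble} (h : Realizes lam rho G)
    {l : ℕ} (T : Shape l) :
    Tendsto (fun k => (G k).shapeFreq T) atTop (𝓝 (T.prob lam rho)) := by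
  have hv := h.tendsto_card_vsocket
  have hc : Tendsto (fun k => Nat.card (G k).CSocket) atTop atTop := by
    simpa only [Ensemble.card_vsocket_eq] using hv
  have h1 := tendsto_card_labeling T.varDeg (fun k => (G k).dv) lam (fun d => lam.apply_ne_top d) hv
    fun d => by
      have := h.var d
      simp only [Ensemble.varEdgeFraction, ← Nat.card_eq_fintype_card] at this
      exact this
  have h2 := tendsto_card_labeling T.chkDeg (fun k => (G k).dc) rho (fun d => rho.apply_ne_top d) hc
    fun d => by
      have := h.chk d
      simp only [Ensemble.chkEdgeFraction, ← Nat.card_eq_fintype_card] at this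
      exact this
  refine ENNReal.Tendsto.mul h1 (Or.inr ?_) h2 (Or.inr ?_)
  · exact ENNReal.prod_ne_top fun _ _ => rho.apply_ne_top _
  · exact ENNReal.prod_ne_top fun _ _ => lam.apply_ne_top _

/-- The expected error weight when the shape of the computation tree follows the branching
process. -/
def limitErr (lam rho : PMF ℕ+) (W : MBIOSChannel) (A : Multiset ℝ≥0 → ℝ≥0)
    (err : (ZMod 2 → ℝ≥0) → ZMod 2 → ℝ≥0∞) (l : ℕ) : ℝ≥0∞ :=
  ∑' T : Shape l, T.prob lam rho * treeErr W A err T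

/-- Each finite set of shapes contributes its share in the limit, and the total is their supremum.
The edges whose computation tree has repeated nodes are dropped here. -/
lemma limitErr_le_liminf {lam rho : PMF ℕ+} (W : MBIOSChannel) (A : Multiset ℝ≥0 → ℝ≥0)
    {err : (ZMod 2 → ℝ≥0) → ZMod 2 → ℝ≥0∞} (herr : IsEquivariant err)
    (h1 : ∀ m b, err m b ≤ 1) (l : ℕ) {G : ℕ → Ensemble} (hG : Realizes lam rho G)
    {sent : (k : ℕ) → (G k).Graph → Fin (G k).n → ZMod 2}
    (hsent : ∀ k σ, sent k σ ∈ Ensemble.code σ) :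
    limitErr lam rho W A err l ≤ liminf (fun k => Ensemble.average W (sent k) fun σ y s =>
      err (Ensemble.likMsg A σ (fun i b => W.f b (y i)) l s) (sent k σ s.1)) atTop := by
  rw [limitErr, ENNReal.tsum_eq_iSup_sum]
  refine iSup_le fun S => ?_
  have hle : ∀ T : Shape l, treeErr W A err T ≠ ∞ := fun T => by
    refine ne_top_of_le_ne_top ENNReal.one_ne_top ((lintegral_mono fun y => h1 _ _).trans ?_)
    simp
  have hlim : Tendsto (fun k => ∑ T ∈ S, treeErr W A err T * (G k).shapeFreq T) atTop
      (𝓝 (∑ T ∈ S, T.prob lam rho * treeErr W A err T)) := by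
    refine tendsto_finsetSum _ fun T _ => ?_
    rw [mul_comm (T.prob lam rho)]
    exact ENNReal.Tendsto.const_mul (hG.tendsto_shapeFreq T) (Or.inr (hle T))
  rw [← hlim.liminf_eq]
  refine liminf_le_liminf ?_
  filter_upwards [hG.tendsto_card_vsocket.eventually_ge_atTop 1] with k hk
  exact Ensemble.sum_treeErr_mul_shapeFreq_le_average W A herr (by omega) (hsent k) S

/-- An inequality suffices, and needs no measurability of `err`. -/
lemma average_add_average_le (W : MBIOSChannel) {G : Ensemble}
    (sent : G.Graph → Fin G.n → ZMod 2)
    (err : G.Graph → (Fin G.n → ℝ) → G.VSocket → ℝ≥0∞) (h1 : ∀ σ y s, err σ y s ≤ 1) :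
    Ensemble.average W sent err + Ensemble.average W sent (fun σ y s => 1 - err σ y s) ≤ 1 := by
  simp only [Ensemble.average]
  rw [← ENNReal.add_div]
  refine ENNReal.div_le_of_le_mul ?_
  rw [one_mul]
  calc _ = ∑ σ : G.Graph, ∑ s : G.VSocket,
        ((∫⁻ y, err σ y s ∂(Measure.pi fun i => W.law (sent σ i))) +
          ∫⁻ y, (1 - err σ y s) ∂(Measure.pi fun i => W.law (sent σ i))) := by
        simp only [Finset.sum_add_distrib]
    _ ≤ ∑ _σ : G.Graph, ∑ _s : G.VSocket, 1 := by
        refine Finset.sum_le_sum fun σ _ => Finset.sum_le_sum fun s _ => ?_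
        refine (le_lintegral_add _ _).trans ?_
        simp [add_tsub_cancel_of_le (h1 _ _ _)]
    _ = _ := by simp

/-- The computation trees with distinct nodes give a lower bound for the average of `err` and for
that of `1 - err`. In the limit the two bounds add up to one. -/
theorem isAsymptotic_limitErr (lam rho : PMF ℕ+) (W : MBIOSChannel) (A : Multiset ℝ≥0 → ℝ≥0)
    {err : (ZMod 2 → ℝ≥0) → ZMod 2 → ℝ≥0∞} (herr : IsEquivariant err) (h1 : ∀ m b, err m b ≤ 1)
    (l : ℕ) (hmeas : ∀ T : Shape l,
      Measurable fun y : T.Var → ℝ => err (T.treeMsg A fun v b => W.f b (y v)) 0) :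
    IsAsymptotic lam rho (fun _ sent => Ensemble.average W sent fun σ y s =>
      err (Ensemble.likMsg A σ (fun i b => W.f b (y i)) l s) (sent σ s.1))
      (limitErr lam rho W A err l) := by
  intro G hG sent hsent
  have hsum : limitErr lam rho W A err l + limitErr lam rho W A (fun m b => 1 - err m b) l = 1 := by
    rw [limitErr, limitErr, ← ENNReal.tsum_add]
    refine (tsum_congr fun T => ?_).trans (Shape.tsum_prob lam rho l)
    rw [← mul_add, treeErr, treeErr, ← lintegral_add_left (hmeas T)]
    rw [lintegral_congr (g := fun _ => 1) fun y => add_tsub_cancel_of_le (h1 _ _), lintegral_one,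
      measure_univ, mul_one]
  have hlow := limitErr_le_liminf W A herr h1 l hG hsent
  have hlow' := limitErr_le_liminf W A (err := fun m b => 1 - err m b)
    (fun m x b => congrArg (1 - ·) (herr m x b)) (fun m b => tsub_le_self) l hG hsent
  refine tendsto_of_le_liminf_of_limsup_le hlow ?_
  have hne : limitErr lam rho W A (fun m b => 1 - err m b) l ≠ ∞ :=
    ne_top_of_le_ne_top ENNReal.one_ne_top (le_add_self.trans hsum.le)
  rw [ENNReal.eq_sub_of_add_eq hne hsum]
  refine le_trans ?_ (tsub_le_tsub_left hlow' 1)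
  rw [← ENNReal.limsup_const_sub _ _ ENNReal.one_ne_top]
  refine limsup_le_limsup (Eventually.of_forall fun k => ?_)
  exact ENNReal.le_sub_of_add_le_right
    (ne_top_of_le_ne_top ENNReal.one_ne_top (le_add_self.trans
      (average_add_average_le W (sent k) _ fun σ y s => h1 _ _)))
    (average_add_average_le W (sent k) _ fun σ y s => h1 _ _)

/-! ### Measurability of the messages -/

/-- The aggregation rule is measurable, as a function of a finite family of likelihoods. -/
def MeasurableAgg (A : Multiset ℝ≥0 → ℝ≥0) : Prop :=
  ∀ {Ω κ : Type} [MeasurableSpace Ω] [Fintype κ] (g : κ → Ω → ℝ≥0),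
    (∀ k, Measurable (g k)) → Measurable fun ω => A (Finset.univ.val.map fun k => g k ω)

lemma measurableAgg_sum : MeasurableAgg Multiset.sum := fun _ hg =>
  Finset.measurable_sum Finset.univ fun k _ => hg k

lemma measurableAgg_maxAgg : MeasurableAgg maxAgg := fun {Ω κ} _ _ g hg => by
  have h : ∀ s : Finset κ, Measurable fun ω => s.sup fun k => g k ω := by
    classical
    intro s
    induction s using Finset.induction_on with
    | empty => simp
    | insert k s hk ih =>
      simp only [Finset.sup_insert]
      exact (hg k).sup ih
  exact h Finset.univ

lemma measurable_treeMsg {A : Multiset ℝ≥0 → ℝ≥0} (hA : MeasurableAgg A) {Ω : Type}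
    [MeasurableSpace Ω] : ∀ {l : ℕ} (T : Shape l) (w : Ω → T.Var → ZMod 2 → ℝ≥0),
    (∀ v b, Measurable fun ω => w ω v b) → ∀ b, Measurable fun ω => T.treeMsg A (w ω) b
  | _, .leaf _, _, hw, b => hw none b
  | _, .node _ e c, w, hw, b => by
    simp only [Shape.treeMsg]
    refine (hw none b).mul (Finset.measurable_prod _ fun i _ => ?_)
    refine hA (fun (x : {x : Fin (e i) → ZMod 2 // ∑ j, x j = b}) ω =>
      ∏ j, (c i j).treeMsg A (fun v => w ω (Shape.down i j v)) (x.1 j)) fun x => ?_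
    exact Finset.measurable_prod _ fun j _ =>
      measurable_treeMsg hA (c i j) _ (fun v b => hw (Shape.down i j v) b) _

lemma measurable_bitErr_treeMsg (W : MBIOSChannel) {A : Multiset ℝ≥0 → ℝ≥0} (hA : MeasurableAgg A)
    (τ : ℝ≥0∞) {l : ℕ} (T : Shape l) (b : ZMod 2) :
    Measurable fun y : T.Var → ℝ => bitErr τ (T.treeMsg A fun v b => W.f b (y v)) b := by
  have h := measurable_treeMsg hA T (fun (y : T.Var → ℝ) v b => W.f b (y v))
    fun v b => (W.measurable_f b).comp (measurable_pi_apply v)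
  unfold bitErr
  exact Measurable.ite (measurableSet_lt (h _) (h _)) measurable_const
    (Measurable.ite (measurableSet_eq_fun (h _) (h _)) measurable_const measurable_const)

/-! ### The Bhattacharyya bound for min-sum decoding -/

namespace Shape

/-- If `r v ^ 2` bounds the likelihood ratio at each variable node `v`, then `minSum r ^ 2` bounds
the likelihood ratio of the max-product message. At a check node, flipping a bit that is one in a
configuration of odd parity gives one of even parity, so that the ratio is bounded by the largest of
the ratios of the children, and hence by the square of the sum of their square roots. -/
lemma treeMsg_one_le : ∀ {l : ℕ} (T : Shape l) (w : T.Var → ZMod 2 → ℝ≥0) (r : T.Var → ℝ≥0),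
    (∀ v, w v 1 ≤ r v ^ 2 * w v 0) →
    T.treeMsg maxAgg w 1 ≤ T.minSum r ^ 2 * T.treeMsg maxAgg w 0
  | _, .leaf _, _, _, h => h none
  | _, .node d e c, w, r, h => by
    have ih := fun i j => treeMsg_one_le (c i j) (fun v => w (down i j v)) (fun v => r (down i j v))
      fun v => h (down i j v)
    simp only [treeMsg, minSum, mul_pow, ← Finset.prod_pow]
    rw [mul_mul_mul_comm, ← Finset.prod_mul_distrib]
    refine mul_le_mul' (h none) (Finset.prod_le_prod' fun i _ => ?_)
    refine Finset.sup_le fun z _ => ?_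
    obtain ⟨k, hk⟩ : ∃ k, z.1 k = 1 := by
      by_contra! hne
      have h0 : ∀ k, z.1 k = 0 := fun k => by
        have h01 : ∀ b : ZMod 2, b ≠ 1 → b = 0 := by decide
        exact h01 _ (hne k)
      have h1 := z.2
      simp [h0] at h1
    have hz' : ∑ j, Function.update z.1 k 0 j = 0 := by
      rw [Finset.sum_update_of_mem (Finset.mem_univ k), zero_add]
      have h1 := z.2
      rw [← Finset.add_sum_erase _ _ (Finset.mem_univ k), hk, Finset.erase_eq] at h1
      exact add_eq_left.1 h1
    refine le_trans ?_ (mul_le_mul' le_rfl (Finset.le_sup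
      (f := fun x : {x : Fin (e i) → ZMod 2 // ∑ j, x j = 0} =>
        ∏ j, treeMsg maxAgg (c i j) (fun v => w (down i j v)) (x.1 j))
      (Finset.mem_univ ⟨Function.update z.1 k 0, hz'⟩)))
    rw [← Finset.mul_prod_erase _ _ (Finset.mem_univ k),
      ← Finset.mul_prod_erase _ (fun j => treeMsg maxAgg (c i j) (fun v => w (down i j v))
        (Function.update z.1 k 0 j)) (Finset.mem_univ k), hk, Function.update_self, ← mul_assoc]
    refine mul_le_mul' ((ih i k).trans (mul_le_mul' ?_ le_rfl)) (le_of_eq ?_)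
    · exact pow_le_pow_left' (Finset.single_le_sum_of_canonicallyOrdered
        (f := fun j => (c i j).minSum fun v => r (down i j v)) (Finset.mem_univ k)) 2
    · refine Finset.prod_congr rfl fun j hj => ?_
      rw [Function.update_of_ne (Finset.ne_of_mem_erase hj)]

lemma treeMsg_zero_pos : ∀ {l : ℕ} (T : Shape l) (w : T.Var → ZMod 2 → ℝ≥0),
    (∀ v, 0 < w v 0) → 0 < T.treeMsg maxAgg w 0
  | _, .leaf _, _, h => h none
  | _, .node d e c, w, h => by
    simp only [treeMsg]
    refine mul_pos (h none) (Finset.prod_pos fun i _ => ?_)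
    refine lt_of_lt_of_le ?_ (Finset.le_sup
      (f := fun x : {x : Fin (e i) → ZMod 2 // ∑ j, x j = 0} =>
        ∏ j, treeMsg maxAgg (c i j) (fun v => w (down i j v)) (x.1 j))
      (Finset.mem_univ ⟨fun _ => 0, by simp⟩))
    exact Finset.prod_pos fun j _ => treeMsg_zero_pos (c i j) _ fun v => h _

/-- Multiplying out, `minSum` is a sum of products over sets of variable nodes. -/
lemma exists_minSum_eq (R : Type*) [CommSemiring R] : ∀ {l : ℕ} (T : Shape l),
    ∃ (κ : Type) (_ : Fintype κ) (u : κ → T.Var → Bool),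
      ∀ r : T.Var → R, T.minSum r = ∑ k, ∏ v, if u k v then r v else 1
  | _, .leaf _ => ⟨Unit, inferInstance, fun _ _ => true, fun r => by
      simp only [minSum, prod_var_leaf]
      simp⟩
  | _, .node d e c => by
    choose κ hκ u hu using fun i j => exists_minSum_eq R (c i j)
    let U : ∀ i, ((j : Fin (e i)) × κ i j) → (j : Fin (e i)) → (c i j).Var → Bool :=
      fun i x j v => if h : x.1 = j then u i j (h ▸ x.2) v else false
    have hU : ∀ (r : (node d e c).Var → R) (i : Fin d),
        ∑ j, (c i j).minSum (fun v => r (down i j v)) =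
          ∑ x, ∏ j, ∏ v, if U i x j v then r (down i j v) else 1 := fun r i => by
      rw [Fintype.sum_sigma]
      refine Finset.sum_congr rfl fun j _ => ?_
      rw [hu]
      refine Finset.sum_congr rfl fun k _ => ?_
      rw [Finset.prod_eq_single j _ (by simp)]
      · simp [U]
      · intro j' _ hj'
        simp [U, hj'.symm]
    refine ⟨(i : Fin d) → (j : Fin (e i)) × κ i j, inferInstance, fun k v => v.elim true
      fun x : (i : Fin d) × (j : Fin (e i)) × Option (c i j).Inner =>
        U x.1 (k x.1) x.2.1 x.2.2, fun r => ?_⟩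
    simp only [minSum, hU, prod_var]
    rw [Finset.prod_univ_sum, Fintype.piFinset_univ, Finset.mul_sum]
    rfl

end Shape

lemma lintegral_pi_prod {κ : Type*} [Fintype κ] (μ : κ → Measure ℝ)
    [∀ v, IsProbabilityMeasure (μ v)] (g : κ → ℝ → ℝ≥0∞) (hg : ∀ v, Measurable (g v)) :
    ∫⁻ y, ∏ v, g v (y v) ∂(Measure.pi μ) = ∏ v, ∫⁻ y, g v y ∂(μ v) := by
  have h : ProbabilityTheory.iIndepFun (fun v (y : κ → ℝ) => g v (y v)) (Measure.pi μ) :=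
    ProbabilityTheory.iIndepFun_pi fun v => (hg v).aemeasurable
  have h1 := ProbabilityTheory.lintegral_prod_eq_prod_lintegral_of_indepFun Finset.univ _ h
    fun v => (hg v).comp (measurable_pi_apply v)
  refine h1.trans (Finset.prod_congr rfl fun v _ => ?_)
  exact (measurePreserving_eval μ v).lintegral_comp (hg v)

lemma lintegral_minSum (μ : Measure ℝ) [IsProbabilityMeasure μ] {l : ℕ} (T : Shape l)
    {g : ℝ → ℝ≥0∞} (hg : Measurable g) :
    ∫⁻ y, T.minSum (fun v => g (y v)) ∂(Measure.pi fun _ : T.Var => μ) =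
      T.minSum fun _ => ∫⁻ y, g y ∂μ := by
  obtain ⟨κ, _, u, hu⟩ := T.exists_minSum_eq ℝ≥0∞
  simp only [hu]
  have hg' : ∀ k v, Measurable fun y => if u k v then g y else 1 := fun k v => by
    split_ifs
    exacts [hg, measurable_const]
  have hm : ∀ k, Measurable fun y : T.Var → ℝ => ∏ v, if u k v then g (y v) else 1 := fun k =>
    Finset.measurable_prod _ fun v _ => (hg' k v).comp (measurable_pi_apply v)
  rw [lintegral_finsetSum Finset.univ fun k _ => hm k]
  refine Finset.sum_congr rfl fun k _ => ?_
  rw [lintegral_pi_prod (fun _ => μ) (fun v y => if u k v then g y else 1) (hg' k)]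
  refine Finset.prod_congr rfl fun v _ => ?_
  split_ifs <;> simp

namespace Shape

lemma coe_minSum : ∀ {l : ℕ} (T : Shape l) (r : T.Var → ℝ≥0),
    ((T.minSum r : ℝ≥0) : ℝ≥0∞) = T.minSum fun v => (r v : ℝ≥0∞)
  | _, .leaf _, _ => rfl
  | _, .node d e c, r => by
    simp only [minSum, ENNReal.coe_mul, ENNReal.ofNNReal_finsetProd,
      ENNReal.ofNNReal_finsetSum, coe_minSum]

end Shape

namespace MBIOSChannel

variable (W : MBIOSChannel)

/-- The square root of the likelihood ratio of a channel output. -/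
def sqrtRatio (y : ℝ) : ℝ≥0 := NNReal.sqrt (W.f 1 y / W.f 0 y)

lemma measurable_sqrtRatio : Measurable W.sqrtRatio :=
  NNReal.continuous_sqrt.measurable.comp ((W.measurable_f 1).div (W.measurable_f 0))

lemma lintegral_sqrtRatio : ∫⁻ y, (W.sqrtRatio y : ℝ≥0∞) ∂(W.law 0) = W.bhattacharyya := by
  rw [law, lintegral_withDensity_eq_lintegral_mul _ (W.measurable_f 0).coe_nnreal_ennreal
    W.measurable_sqrtRatio.coe_nnreal_ennreal, bhattacharyya]
  refine lintegral_congr fun y => ?_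
  rw [Pi.mul_apply, ← ENNReal.coe_mul, ENNReal.coe_inj, sqrtRatio]
  rcases eq_or_ne (W.f 0 y) 0 with h | h
  · simp [h]
  · have h1 : W.f 0 y * W.f 1 y = W.f 0 y ^ 2 * (W.f 1 y / W.f 0 y) := by field_simp
    rw [h1, NNReal.sqrt_mul, NNReal.sqrt_sq]

lemma bhattacharyya_le_one : W.bhattacharyya ≤ 1 := by
  have h : ∀ a b : ℝ≥0, NNReal.sqrt (a * b) ≤ 2⁻¹ * a + 2⁻¹ * b := fun a b => by
    rw [NNReal.sqrt_le_iff_le_sq, ← NNReal.coe_le_coe]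
    push_cast
    nlinarith [sq_nonneg ((a : ℝ) - b)]
  calc W.bhattacharyya ≤ ∫⁻ y, ((2⁻¹ : ℝ≥0) * (W.f 0 y : ℝ≥0∞) + (2⁻¹ : ℝ≥0) * (W.f 1 y : ℝ≥0∞))
        ∂W.ref := lintegral_mono fun y => by
          rw [← ENNReal.coe_mul, ← ENNReal.coe_mul, ← ENNReal.coe_add]
          exact ENNReal.coe_le_coe.2 (h (W.f 0 y) (W.f 1 y))
    _ = (2⁻¹ : ℝ≥0) + (2⁻¹ : ℝ≥0) := by
        rw [lintegral_add_left (by have := (W.measurable_f 0).coe_nnreal_ennreal; fun_prop),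
          lintegral_const_mul _ (W.measurable_f 0).coe_nnreal_ennreal,
          lintegral_const_mul _ (W.measurable_f 1).coe_nnreal_ennreal, W.lintegral_f,
          W.lintegral_f, mul_one]
    _ = 1 := by
        rw [← ENNReal.coe_add, ← two_mul, mul_inv_cancel₀ two_ne_zero, ENNReal.coe_one]

lemma ae_pos : ∀ᵐ y ∂(W.law 0), 0 < W.f 0 y := by
  rw [law, ae_withDensity_iff (W.measurable_f 0).coe_nnreal_ennreal]
  refine Eventually.of_forall fun y hy => ?_
  rw [ENNReal.coe_ne_zero] at hy
  exact pos_iff_ne_zero.2 hy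

end MBIOSChannel

/-- When the decision is wrong or tied, `minSum` of the square roots of the likelihood ratios is at
least one. Its expectation is obtained by inserting the Bhattacharyya parameter. -/
lemma treeErr_maxAgg_le (W : MBIOSChannel) {τ : ℝ≥0∞} (hτ : τ ≤ 1) {l : ℕ} (T : Shape l) :
    treeErr W maxAgg (bitErr τ) T ≤ T.minSum fun _ => W.bhattacharyya := by
  rw [← W.lintegral_sqrtRatio, ← lintegral_minSum (W.law 0) T
    W.measurable_sqrtRatio.coe_nnreal_ennreal, treeErr]
  refine lintegral_mono_ae ?_
  have hpos : ∀ᵐ y ∂(Measure.pi fun _ : T.Var => W.law 0), ∀ v, 0 < W.f 0 (y v) :=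
    ae_all_iff.2 fun v =>
      (Measure.quasiMeasurePreserving_eval (fun _ : T.Var => W.law 0) v).ae W.ae_pos
  filter_upwards [hpos] with y hy
  set w : T.Var → ZMod 2 → ℝ≥0 := fun v b => W.f b (y v)
  rw [← T.coe_minSum]
  have h1 := T.treeMsg_one_le w (fun v => W.sqrtRatio (y v)) fun v => by
    rw [MBIOSChannel.sqrtRatio, NNReal.sq_sqrt, div_mul_cancel₀ _ (hy v).ne']
  have h0 := T.treeMsg_zero_pos w hy
  have hle : T.treeMsg maxAgg w 0 ≤ T.treeMsg maxAgg w 1 →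
      1 ≤ T.minSum fun v => W.sqrtRatio (y v) := fun h => by
    have h2 := h.trans h1
    by_contra! hlt
    have h3 : (T.minSum fun v => W.sqrtRatio (y v)) ^ 2 < 1 := pow_lt_one₀ zero_le hlt two_ne_zero
    exact absurd h2 (not_le.2 (mul_lt_of_lt_one_left h0 h3))
  simp only [bitErr, zero_add]
  split_ifs with h h'
  · exact_mod_cast hle h.le
  · exact hτ.trans (by exact_mod_cast hle h'.le)
  · exact zero_le

/-! ### Optimality of sum-product decoding on trees -/

namespace Shape

/-- On a tree, the sum-product message is the sum of the likelihoods of the codewords. -/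
lemma exists_treeMsg_sum_eq : ∀ {l : ℕ} (T : Shape l) (b : ZMod 2),
    ∃ (κ : Type) (_ : Fintype κ) (word : κ → T.Var → ZMod 2),
      (∀ k, T.IsCodeword (word k)) ∧ (∀ k, word k none = b) ∧ (b = 0 → Nonempty κ) ∧
      ∀ w : T.Var → ZMod 2 → ℝ≥0, T.treeMsg Multiset.sum w b = ∑ k, ∏ v, w v (word k v)
  | _, .leaf _, b => ⟨Unit, inferInstance, fun _ _ => b, fun _ => trivial, fun _ => rfl,
      fun _ => inferInstance, fun w => by
        simp only [treeMsg, prod_var_leaf]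
        simp⟩
  | _, .node d e c, b => by
    choose κ hκ word hcw hroot hne hw using fun i j b => exists_treeMsg_sum_eq (c i j) b
    let K : Fin d → Type := fun i =>
      (z : {z : Fin (e i) → ZMod 2 // ∑ j, z j = b}) × ((j : Fin (e i)) → κ i j (z.1 j))
    refine ⟨(i : Fin d) → K i, inferInstance, fun k v => v.elim b
      fun x : (i : Fin d) × (j : Fin (e i)) × Option (c i j).Inner =>
        word x.1 x.2.1 _ ((k x.1).2 x.2.1) x.2.2, fun k i => ⟨?_, fun j =>
        hcw i j ((k i).1.1 j) ((k i).2 j)⟩,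
        fun _ => rfl, ?_, fun w => ?_⟩
    · refine (k i).1.2.symm.trans (Finset.sum_congr rfl fun j _ => ?_)
      exact (hroot i j _ _).symm
    · rintro rfl
      have h : ∀ i j, Nonempty (κ i j 0) := fun i j => hne i j 0 rfl
      exact ⟨fun i => ⟨⟨fun _ => 0, by simp⟩, fun j => (h i j).some⟩⟩
    · have hsum : ∀ i, ∑ z : {z : Fin (e i) → ZMod 2 // ∑ j, z j = b},
          ∏ j, (c i j).treeMsg Multiset.sum (fun v => w (down i j v)) (z.1 j) =
          ∑ x : K i, ∏ j, ∏ v, w (down i j v) (word i j _ (x.2 j) v) := fun i => by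
        rw [Fintype.sum_sigma]
        refine Finset.sum_congr rfl fun z _ => ?_
        simp only [hw]
        rw [Finset.prod_univ_sum, Fintype.piFinset_univ]
      have hnode : (node d e c).treeMsg Multiset.sum w b = w none b *
          ∏ i, ∑ z : {z : Fin (e i) → ZMod 2 // ∑ j, z j = b},
          ∏ j, (c i j).treeMsg Multiset.sum (fun v => w (down i j v)) (z.1 j) := rfl
      rw [hnode]
      simp only [hsum, prod_var]
      rw [Finset.prod_univ_sum, Fintype.piFinset_univ, Finset.mul_sum]
      rfl

end Shape

namespace MBIOSChannel

variable (W : MBIOSChannel)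

/-- The law of the channel output when the input is a fair bit. -/
def outputLaw : Measure ℝ := (2⁻¹ : ℝ≥0∞) • (W.law 0 + W.law 1)

instance : IsProbabilityMeasure W.outputLaw := ⟨by
  simp only [outputLaw, Measure.smul_apply, Measure.add_apply, measure_univ, smul_eq_mul]
  rw [one_add_one_eq_two, ENNReal.inv_mul_cancel two_ne_zero ENNReal.ofNat_ne_top]⟩

/-- Half the sum of the two transition densities. -/
def meanDensity (y : ℝ) : ℝ≥0 := (W.f 0 y + W.f 1 y) / 2

/-- The density of the channel output given the bit `b` with respect to `outputLaw`, which, unlike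
the reference measure of the channel, is always finite. -/
def relDensity (b : ZMod 2) (y : ℝ) : ℝ≥0 := W.f b y / W.meanDensity y

lemma measurable_meanDensity : Measurable W.meanDensity :=
  ((W.measurable_f 0).add (W.measurable_f 1)).div_const 2

lemma measurable_relDensity (b : ZMod 2) : Measurable (W.relDensity b) :=
  (W.measurable_f b).div W.measurable_meanDensity

lemma mean_mul_rel (b : ZMod 2) (y : ℝ) : W.meanDensity y * W.relDensity b y = W.f b y := by
  rcases eq_or_ne (W.meanDensity y) 0 with h | h
  · have h1 : W.f 0 y + W.f 1 y = 0 := by simpa [meanDensity] using h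
    have h2 := add_eq_zero.1 h1
    have hb : b = 0 ∨ b = 1 := by revert b; decide
    rcases hb with rfl | rfl <;> simp [h, h2]
  · rw [relDensity, mul_div_cancel₀ _ h]

lemma law_eq_withDensity (b : ZMod 2) :
    W.law b = W.outputLaw.withDensity fun y => (W.relDensity b y : ℝ≥0∞) := by
  have h : W.outputLaw = W.ref.withDensity fun y => (W.meanDensity y : ℝ≥0∞) := by
    rw [outputLaw, law, law, ← withDensity_add_left (W.measurable_f 0).coe_nnreal_ennreal,
      ← withDensity_smul _ (((W.measurable_f 0).coe_nnreal_ennreal).add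
        (W.measurable_f 1).coe_nnreal_ennreal)]
    congr 1
    funext y
    simp only [Pi.smul_apply, Pi.add_apply, smul_eq_mul, meanDensity]
    rw [ENNReal.coe_div two_ne_zero, ENNReal.coe_add, ENNReal.coe_ofNat, mul_comm, div_eq_mul_inv]
  rw [h, ← withDensity_mul _ W.measurable_meanDensity.coe_nnreal_ennreal
    (W.measurable_relDensity b).coe_nnreal_ennreal, law]
  congr 1
  funext y
  rw [Pi.mul_apply, ← ENNReal.coe_mul, mean_mul_rel]

end MBIOSChannel

lemma pi_withDensity {κ : Type*} [Fintype κ] (μ : Measure ℝ) [IsProbabilityMeasure μ]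
    (g : κ → ℝ → ℝ≥0∞) (hg : ∀ v, Measurable (g v))
    (h : ∀ v, IsProbabilityMeasure (μ.withDensity (g v))) :
    Measure.pi (fun v => μ.withDensity (g v)) =
      (Measure.pi fun _ => μ).withDensity fun y => ∏ v, g v (y v) := by
  refine Measure.pi_eq fun s hs => ?_
  rw [withDensity_apply _ (MeasurableSet.univ_pi hs),
    ← lintegral_indicator (MeasurableSet.univ_pi hs)]
  have h1 : (Set.univ.pi s).indicator (fun y : κ → ℝ => ∏ v, g v (y v)) =
      fun y => ∏ v, (s v).indicator (g v) (y v) := by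
    funext y
    by_cases hy : y ∈ Set.univ.pi s
    · rw [Set.indicator_of_mem hy]
      exact Finset.prod_congr rfl fun v _ => (Set.indicator_of_mem (hy v trivial) _).symm
    · rw [Set.indicator_of_notMem hy]
      simp only [Set.mem_pi, Set.mem_univ, true_implies, not_forall] at hy
      obtain ⟨v, hv⟩ := hy
      exact (Finset.prod_eq_zero (Finset.mem_univ v) (Set.indicator_of_notMem hv _)).symm
  rw [h1, lintegral_pi_prod (fun _ => μ) (fun v => (s v).indicator (g v))
    fun v => (hg v).indicator (hs v)]
  refine Finset.prod_congr rfl fun v _ => ?_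
  rw [withDensity_apply _ (hs v), lintegral_indicator (hs v)]

lemma one_le_bitErr_add_bitErr {τ : ℝ≥0∞} (hτ : 2⁻¹ ≤ τ) (m : ZMod 2 → ℝ≥0) :
    1 ≤ bitErr τ m 0 + bitErr τ m 1 := by
  have h2 : (1 + 1 : ZMod 2) = 0 := by decide
  simp only [bitErr, zero_add, h2]
  rcases lt_trichotomy (m 0) (m 1) with h | h | h
  · simp [h]
  · simp only [h, lt_irrefl, if_false, if_true]
    calc (1 : ℝ≥0∞) = 2⁻¹ + 2⁻¹ := ENNReal.inv_two_add_inv_two.symm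
      _ ≤ τ + τ := add_le_add hτ hτ
  · simp [h]

/-- Deciding for the larger of the two likelihoods minimizes the error. -/
lemma bitErr_mul_add_le {τ : ℝ≥0∞} (hτ : 2⁻¹ ≤ τ) (m m' : ZMod 2 → ℝ≥0) :
    bitErr 2⁻¹ m 0 * m 0 + bitErr 2⁻¹ m 1 * m 1 ≤
      bitErr τ m' 0 * m 0 + bitErr τ m' 1 * m 1 := by
  have h1 := one_le_bitErr_add_bitErr hτ m'
  generalize bitErr τ m' 0 = e at h1 ⊢
  generalize bitErr τ m' 1 = e' at h1 ⊢
  have key : ∀ x : ℝ≥0, x ≤ m 0 → x ≤ m 1 → (x : ℝ≥0∞) ≤ e * m 0 + e' * m 1 := fun x hx hx' =>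
    calc (x : ℝ≥0∞) = 1 * x := (one_mul _).symm
      _ ≤ (e + e') * x := by gcongr
      _ = e * x + e' * x := add_mul _ _ _
      _ ≤ _ := by gcongr
  have h2 : (1 + 1 : ZMod 2) = 0 := by decide
  simp only [bitErr, zero_add, h2]
  rcases lt_trichotomy (m 0) (m 1) with h | h | h
  · simpa [h, h.not_gt, h.ne'] using key _ le_rfl h.le
  · simp only [h, lt_irrefl, if_false, if_true, ← add_mul, ENNReal.inv_two_add_inv_two, one_mul]
    have := key (m 1) h.ge le_rfl
    simpa only [h, ← add_mul] using this
  · simpa [h, h.not_gt, h.ne'] using key _ h.le le_rfl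

lemma bitErr_const_mul (τ : ℝ≥0∞) {C : ℝ≥0} (hC : C ≠ 0) (m : ZMod 2 → ℝ≥0) :
    bitErr τ (fun b => C * m b) = bitErr τ m := by
  funext b
  have hC' : 0 < C := pos_iff_ne_zero.2 hC
  simp only [bitErr, mul_lt_mul_iff_right₀ hC', mul_right_inj' hC]

/-- Averaging over all codewords turns the sum-product message into the posterior distribution of
the bit at the root, so that no other decision has a smaller error. -/
lemma treeErr_sum_le (W : MBIOSChannel) {A : Multiset ℝ≥0 → ℝ≥0} (hA : MeasurableAgg A)
    {τ : ℝ≥0∞} (hτ : 2⁻¹ ≤ τ) {l : ℕ} (T : Shape l) :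
    treeErr W Multiset.sum (bitErr 2⁻¹) T ≤ treeErr W A (bitErr τ) T := by
  choose κ hκ word hcw hroot hne hw using fun b => T.exists_treeMsg_sum_eq b
  -- The sum-product message of the normalized densities.
  let m : (T.Var → ℝ) → ZMod 2 → ℝ≥0 := fun y b => ∑ k, ∏ v, W.relDensity (word b k v) (y v)
  have hmm : ∀ b, Measurable fun y => (m y b : ℝ≥0∞) := fun b =>
    (Finset.measurable_sum _ fun k _ => Finset.measurable_prod _ fun v _ =>
      (W.measurable_relDensity _).comp (measurable_pi_apply v)).coe_nnreal_ennreal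
  have hd : ∀ b k, Measurable fun y : T.Var → ℝ =>
      ∏ v, (W.relDensity (word b k v) (y v) : ℝ≥0∞) := fun b k =>
    Finset.measurable_prod _ fun v _ =>
      ((W.measurable_relDensity _).comp (measurable_pi_apply v)).coe_nnreal_ennreal
  have hint : ∀ {B : Multiset ℝ≥0 → ℝ≥0}, MeasurableAgg B → ∀ (θ : ℝ≥0∞) (b : ZMod 2),
      (Fintype.card (κ b) : ℝ≥0∞) * treeErr W B (bitErr θ) T =
        ∫⁻ y, bitErr θ (T.treeMsg B fun v b => W.f b (y v)) b * m y b
          ∂(Measure.pi fun _ : T.Var => W.outputLaw) := by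
    intro B hB θ b
    have hk : ∀ k : κ b, treeErr W B (bitErr θ) T =
        ∫⁻ y, bitErr θ (T.treeMsg B fun v b => W.f b (y v)) b *
          ∏ v, (W.relDensity (word b k v) (y v) : ℝ≥0∞)
            ∂(Measure.pi fun _ : T.Var => W.outputLaw) := fun k => by
      rw [← lintegral_codeword_eq_treeErr W B (isEquivariant_bitErr θ) T (hcw b k), hroot]
      simp only [W.law_eq_withDensity]
      rw [pi_withDensity W.outputLaw (fun v y => (W.relDensity (word b k v) y : ℝ≥0∞))
        (fun v => (W.measurable_relDensity _).coe_nnreal_ennreal)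
        (fun v => by rw [← W.law_eq_withDensity]; infer_instance),
        lintegral_withDensity_eq_lintegral_mul _ (hd b k)
          (measurable_bitErr_treeMsg W hB θ T b)]
      exact lintegral_congr fun y => mul_comm _ _
    calc (Fintype.card (κ b) : ℝ≥0∞) * treeErr W B (bitErr θ) T
        = ∑ _k : κ b, treeErr W B (bitErr θ) T := by
          rw [Finset.sum_const, nsmul_eq_mul, Finset.card_univ]
      _ = _ := Finset.sum_congr rfl fun k _ => hk k
      _ = _ := by
          have hm : ∀ k, Measurable fun y : T.Var → ℝ =>
              bitErr θ (T.treeMsg B fun v b => W.f b (y v)) b *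
                ∏ v, (W.relDensity (word b k v) (y v) : ℝ≥0∞) := fun k =>
            (measurable_bitErr_treeMsg W hB θ T b).mul (hd b k)
          rw [← lintegral_finsetSum _ fun k _ => hm k]
          refine lintegral_congr fun y => ?_
          rw [← Finset.mul_sum]
          simp only [m, ENNReal.ofNNReal_finsetSum, ENNReal.ofNNReal_finsetProd]
  have hsum : ∀ {B : Multiset ℝ≥0 → ℝ≥0}, MeasurableAgg B → ∀ θ : ℝ≥0∞,
      (Fintype.card (κ 0) + Fintype.card (κ 1) : ℝ≥0∞) * treeErr W B (bitErr θ) T =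
        ∫⁻ y, (bitErr θ (T.treeMsg B fun v b => W.f b (y v)) 0 * m y 0 +
          bitErr θ (T.treeMsg B fun v b => W.f b (y v)) 1 * m y 1)
          ∂(Measure.pi fun _ : T.Var => W.outputLaw) := by
    intro B hB θ
    have hm : Measurable fun y : T.Var → ℝ =>
        bitErr θ (T.treeMsg B fun v b => W.f b (y v)) 0 * (m y 0 : ℝ≥0∞) :=
      (measurable_bitErr_treeMsg W hB θ T 0).mul (hmm 0)
    rw [lintegral_add_left hm, ← hint hB,
      ← hint hB, add_mul]
  have hmsg : ∀ y : T.Var → ℝ, (T.treeMsg Multiset.sum fun v b => W.f b (y v)) =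
      fun b => (∏ v, W.meanDensity (y v)) * m y b := fun y => by
    funext b
    simp only [hw, m, Finset.mul_sum, ← Finset.prod_mul_distrib, W.mean_mul_rel]
  have hle : (Fintype.card (κ 0) + Fintype.card (κ 1) : ℝ≥0∞) *
      treeErr W Multiset.sum (bitErr 2⁻¹) T ≤
      (Fintype.card (κ 0) + Fintype.card (κ 1) : ℝ≥0∞) * treeErr W A (bitErr τ) T := by
    rw [hsum measurableAgg_sum, hsum hA]
    refine lintegral_mono fun y => ?_
    rw [hmsg y]
    by_cases hC : ∏ v, W.meanDensity (y v) = 0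
    · have hm0 : ∀ b, m y b = 0 := fun b => by
        obtain ⟨v, -, hv⟩ := Finset.prod_eq_zero_iff.1 hC
        refine Finset.sum_eq_zero fun k _ => Finset.prod_eq_zero (Finset.mem_univ v) ?_
        rw [MBIOSChannel.relDensity, hv, div_zero]
      simp [hm0]
    · rw [bitErr_const_mul _ hC]
      exact bitErr_mul_add_le hτ _ _
  have : Nonempty (κ 0) := hne 0 rfl
  have h0 : (Fintype.card (κ 0) + Fintype.card (κ 1) : ℝ≥0∞) ≠ 0 := by
    have : Fintype.card (κ 0) ≠ 0 := Fintype.card_ne_zero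
    simp [this]
  exact (ENNReal.mul_le_mul_iff_right h0 (by finiteness)).1 hle

lemma bitErr_le_one {τ : ℝ≥0∞} (hτ : τ ≤ 1) (m : ZMod 2 → ℝ≥0) (b : ZMod 2) :
    bitErr τ m b ≤ 1 := by
  unfold bitErr
  split_ifs
  exacts [le_rfl, hτ, zero_le]

end LDPC

end

theorem mainTheorem1 (lam rho : PMF ℕ+) (W : LDPC.MBIOSChannel)
    (τ : ℝ≥0∞) (hτ : 2⁻¹ ≤ τ) (hτ' : τ ≤ 1) :
    ∃ PSP PMS : ℕ → ℝ≥0∞,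
      (∀ l, LDPC.IsAsymptotic lam rho
        (fun _ sent => LDPC.Ensemble.spAverage W sent l) (PSP l)) ∧
      (∀ l, LDPC.IsAsymptotic lam rho
        (fun _ sent => LDPC.Ensemble.msAverage W τ sent l) (PMS l)) ∧
      ∀ l, PSP l ≤ PMS l ∧ PMS l ≤ LDPC.zSeq lam rho W.bhattacharyya l := by
  open LDPC in
  refine ⟨limitErr lam rho W Multiset.sum (bitErr 2⁻¹), limitErr lam rho W maxAgg (bitErr τ),
    fun l => ?_, fun l => ?_, fun l => ⟨?_, ?_⟩⟩
  · have h := isAsymptotic_limitErr lam rho W Multiset.sum (isEquivariant_bitErr 2⁻¹)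
      (bitErr_le_one (hτ.trans hτ')) l
      fun T => measurable_bitErr_treeMsg W measurableAgg_sum 2⁻¹ T 0
    convert h using 3 with G sent
    unfold Ensemble.spAverage
    congr 1
    funext σ y s
    rw [Ensemble.spErr_eq_bitErr]
    congr 1
    funext b
    exact Ensemble.spMsg_eq_likMsg W σ y l s b
  · have h := isAsymptotic_limitErr lam rho W maxAgg (isEquivariant_bitErr τ)
      (bitErr_le_one hτ') l fun T => measurable_bitErr_treeMsg W measurableAgg_maxAgg τ T 0
    convert h using 3 with G sent
    unfold Ensemble.msAverage
    congr 1
    funext σ y s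
    rw [← Ensemble.msErr_neg_log]
    congr 1
    funext b
    exact Ensemble.msMsg_eq_neg_log_likMsg W σ y l s b
  · exact ENNReal.tsum_le_tsum fun T =>
      mul_le_mul' le_rfl (treeErr_sum_le W measurableAgg_maxAgg hτ T)
  · exact (ENNReal.tsum_le_tsum fun T => mul_le_mul' le_rfl (treeErr_maxAgg_le W hτ' T)).trans
      (Shape.tsum_prob_mul_minSum_le lam rho W.bhattacharyya_le_one l)
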